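/- Let $T$ be the complete theory, in a language $L$, of an infinite densely ordered o-minimal structure. Let $T^{\mathrm{indep}}$ be the theory, in $L_H = L\cup\{H\}$ with $H$ a new unary predicate, of the $H$-structures of $T$: its models are the structures $(M,H)$ with $M\models T$, $H\subseteq M$, such that for all $n,m,k$ and all $L$-formulas $\varphi,\psi$: 1. (independence) if $x_1,\dots,x_n,x\in H$, $x\neq x_i$ for all $i$, and $\psi(x_1,\dots,x_n,M)$ has fewer than $k$ elements, then $M\models\neg\psi(x_1,\dots,x_n,x)$; 2. (density) for all $x_1,\dots,x_n\in M$, if $\varphi(x_1,\dots,x_n,M)$ is infinite, then it meets $H$; 3. (extension) for all $x_1,\dots,x_n\in M$, if $\varphi(x_1,\dots,x_n,M)$ is infinite and $\psi(x_1,\dots,x_n,y_1,\dots,y_m,M)$ has fewer than $k$ elements for all $y_1,\dots,y_m\in M$, then there is $x\in\varphi(x_1,\dots,x_n,M)$ with $M\models\neg\psi(x_1,\dots,x_n,h_1,\dots,h_m,x)$ for all $h_1,\dots,h_m\in H$. Let $(\mathfrak C,H)$ be the monster model of $T^{\mathrm{indep}}$, that is, a saturated model whose cardinality is a strongly inaccessible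 cardinal greater than $|L|$. Let $f$ be a $0$-definable binary function (in $\mathfrak C$) such that * for all $x,y\in\mathfrak C$, $f(x,y)$ is interdefinable with $y$ over $x$ and interdefinable with $x$ over $y$; * for every interval $(a,b)$ with $a<b$ there is an interval $(a',b')$ with $a'<b'$ such that $f(x,y)\in(a,b)$ for all $x,y\in(a',b')$. Then for every $H'\supseteq H$ that is a basis of $\mathfrak C$ with respect to definable closure (that is, $h\notin\mathrm{dcl}(H'\smallsetminus\{h\})$ for all $h\in H'$, and $\mathrm{dcl}(H')=\mathfrak C$), we have $(\mathfrak C,H)\equiv(\mathfrak C,H')$ and $(\mathfrak C,H)\not\cong(\mathfrak C,H')$ as $L_H$-structures. Moreover $o(H)\neq e(H)$, where $o(H)=\{\sigma(H)\mid\sigma\in\mathrm{Aut}(\mathfrak C)\}$ and $e(H)=\{D\subseteq\mathfrak C\mid(\mathfrak C,H)\equiv(\mathfrak C,D)\}$. -/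

import Mathlib

open FirstOrder Cardinal

universe u v w w'

namespace HStruct

/-! ### Expansions by a unary predicate -/

/-- The relation symbols of the language with a single unary predicate `H`. -/
inductive PredRel : ℕ → Type
  | H : PredRel 1

/-- The language with a single unary predicate `H`. -/
def predLang : FirstOrder.Language.{0, 0} := ⟨fun _ => Empty, PredRel⟩

/-- The language `L_H = L ∪ {H}`. -/
abbrev langH (L : FirstOrder.Language.{u, v}) : FirstOrder.Language.{u, v} := L.sum predLang

/-- The underlying type of the expansion `(M, D)`; it carries the `L_H`-structure below. -/
def Expansion {M : Type w} (_D : Set M) : Type w := M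

instance {L : FirstOrder.Language.{u, v}} {M : Type w} [L.Structure M] (D : Set M) :
    L.Structure (Expansion D) := inferInstanceAs (L.Structure M)

/-- In `(M, D)` the predicate `H` is interpreted as `D`. Together with the preceding instance
this makes `(M, D)` a structure for the sum language `langH L`. -/
instance {M : Type w} (D : Set M) : predLang.Structure (Expansion D) where
  funMap := fun f => Empty.elim f
  RelMap := fun {_} R => match R with
    | PredRel.H => fun x => (show M from x 0) ∈ D

/-! ### Definable closure -/

section Closure

variable (L : FirstOrder.Language.{u, v}) {M : Type w} [L.Structure M]

/-- The definable closure: the elements `a` such that `{a}` is definable with parameters in `A`. -/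
def dcl (A : Set M) : Set M := {a | A.Definable₁ L {a}}

/-- `a` and `b` are interdefinable over `A`. -/
def Interdefinable (A : Set M) (a b : M) : Prop :=
  a ∈ dcl L (insert b A) ∧ b ∈ dcl L (insert a A)

/-- `B` is a basis of `M` for definable closure: independent and generating. -/
def IsDclBasis (B : Set M) : Prop :=
  (∀ b ∈ B, b ∉ dcl L (B \ {b})) ∧ dcl L B = Set.univ

/-- The binary function `f` is definable without parameters. -/
def ZeroDefinable₂ (f : M → M → M) : Prop :=
  (∅ : Set M).Definable L {t : Fin 3 → M | f (t 0) (t 1) = t 2}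

end Closure

/-! ### O-minimality -/

/-- Points and open intervals with endpoints in `M ∪ {-∞, +∞}`. -/
def IsPointOrInterval {M : Type w} [LinearOrder M] (J : Set M) : Prop :=
  (∃ a, J = {a}) ∨ (∃ a b, J = Set.Ioo a b) ∨ (∃ a, J = Set.Iio a) ∨ (∃ a, J = Set.Ioi a) ∨
    J = Set.univ

/-- An ordered structure is o-minimal if every subset of the line that is definable with
parameters is a finite union of points and open intervals. -/
def IsOMinimal (L : FirstOrder.Language.{u, v}) (M : Type w) [L.Structure M] [LinearOrder M] : Prop :=
  ∀ s : Set M, (Set.univ : Set M).Definable₁ L s →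
    ∃ F : Set (Set M), F.Finite ∧ (∀ J ∈ F, IsPointOrInterval J) ∧ s = ⋃₀ F

/-- `T` is (an axiomatization of) the complete theory of an infinite densely ordered o-minimal
structure. Only the existence of one such model is required. -/
def IsOMinimalTheory {L : FirstOrder.Language.{u, v}} [L.IsOrdered] (T : L.Theory) : Prop :=
  T.IsComplete ∧
    ∃ (M : Type w) (_ : L.Structure M) (_ : LinearOrder M),
      L.OrderedStructure M ∧ Infinite M ∧ DenselyOrdered M ∧ IsOMinimal L M ∧ M ⊨ T

/-! ### The theory of `H`-structures -/

/-- The set of solutions `x` of `φ(a, x)`. -/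
def solutions {L : FirstOrder.Language.{u, v}} {M : Type w} [L.Structure M] {α : Type}
    (φ : L.Formula (α ⊕ Unit)) (a : α → M) : Set M :=
  {x | φ.Realize (Sum.elim a fun _ => x)}

/-- `(M, H)` is a model of the theory of `H`-structures of `T`: `M` is a model of `T` and `(M, H)`
satisfies all the axioms of the three schemes. The quantifiers `∃^{<k} x` and `∃^∞ x` are
written through the number of solutions. -/
structure ModelsIndep {L : FirstOrder.Language.{u, v}} (T : L.Theory) {M : Type w} [L.Structure M]
    (H : Set M) : Prop where
  models : M ⊨ T
  /-- `H` is a set of independent elements: if `x₁, …, xₙ, x ∈ H`, `x` is different from all `xᵢ`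
  and `ψ(x₁, …, xₙ, ·)` has fewer than `k` solutions, then `x` is not one of them. -/
  independent : ∀ (n k : ℕ) (ψ : L.Formula (Fin n ⊕ Unit)) (a : Fin n → M) (x : M),
    (∀ i, a i ∈ H) → x ∈ H → (∀ i, x ≠ a i) → (solutions ψ a).encard < k → x ∉ solutions ψ a
  /-- Density: if `φ(a, ·)` has infinitely many solutions, then one of them is in `H`. -/
  density : ∀ (n : ℕ) (φ : L.Formula (Fin n ⊕ Unit)) (a : Fin n → M),
    (solutions φ a).Infinite → ∃ x ∈ H, x ∈ solutions φ a
  /-- Extension: if `φ(a, ·)` has infinitely many solutions and `ψ(a, y, ·)` has fewer than `k`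
  solutions for all `y`, then some solution of `φ(a, ·)` is not a solution of `ψ(a, h, ·)` for
  any tuple `h` of elements of `H`. -/
  extension : ∀ (n m k : ℕ) (φ : L.Formula (Fin n ⊕ Unit))
    (ψ : L.Formula ((Fin n ⊕ Fin m) ⊕ Unit)) (a : Fin n → M),
    (∀ y : Fin m → M, (solutions ψ (Sum.elim a y)).encard < k) → (solutions φ a).Infinite →
      ∃ x ∈ solutions φ a, ∀ h : Fin m → M, (∀ i, h i ∈ H) → x ∉ solutions ψ (Sum.elim a h)

/-! ### Monster models, orbits and elementary classes -/

/-- `M` is `κ`-saturated: every finitely satisfiable set of formulas in one variable over fewer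
than `κ` parameters is realized in `M`. -/
def IsSaturated (L : FirstOrder.Language.{u, v}) (M : Type w) [L.Structure M] (κ : Cardinal.{w}) : Prop :=
  ∀ A : Set M, #A < κ → ∀ p : Set (L[[A]].Formula Unit),
    (∀ q : Set (L[[A]].Formula Unit), q.Finite → q ⊆ p →
      ∃ x : M, ∀ φ ∈ q, φ.Realize fun _ => x) →
    ∃ x : M, ∀ φ ∈ p, φ.Realize fun _ => x

/-- `M` is a monster model (of its complete theory): a saturated model whose cardinality `κ` is
strongly inaccessible and larger than the cardinality of the language. -/
structure IsMonster (L : FirstOrder.Language.{u, v}) (M : Type w) [L.Structure M] (κ : Cardinal.{w}) :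
    Prop where
  inaccessible : κ.IsInaccessible
  card_language_lt : Cardinal.lift.{w} L.card < Cardinal.lift.{max u v} κ
  card_eq : #M = κ
  saturated : IsSaturated L M κ

/-- `o(D)`: the images of `D` under the automorphisms of `M`. -/
def orbit (L : FirstOrder.Language.{u, v}) {M : Type w} [L.Structure M] (D : Set M) : Set (Set M) :=
  {D' | ∃ σ : M ≃[L] M, σ '' D = D'}

/-- `e(D)`: the sets `D'` such that `(M, D)` and `(M, D')` are elementarily equivalent. -/
def elemClass (L : FirstOrder.Language.{u, v}) {M : Type w} [L.Structure M] (D : Set M) : Set (Set M) :=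
  {D' | (langH L).ElementarilyEquivalent (Expansion D) (Expansion D')}

end HStruct

/-! The `H`-structure axioms do not bound how much of the model the predicate generates, whereas
isomorphism sees it. By the extension axiom and saturation some `c` is not algebraic over `H`; then
`H ∪ {c}` is still independent, so `H` is not a maximal independent set. Automorphisms preserve
independence, hence no automorphism of the `L`-reduct carries `H` onto a maximal independent set, in
particular onto a basis (`image_ne_of_maximal`).

It remains to see that every independent `D ⊇ H` gives an elementarily equivalent expansion. Density
is inherited from `H`; the extension axiom is where `f` enters. Iterating `f` on `m + 1` points of
`D` produces a point of any prescribed interval that is interalgebraic with each of these points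
over the others. Such a point is not algebraic over given parameters and `m` elements of `D`
(`isHStructure_of_indepOver`). An infinite definable set contains an interval, so this suffices.
That fact is transferred from the o-minimal model of `T` by means of uniform finiteness, which
itself follows from density, independence and saturation (`IsDense.uniformFinite`).

Finally, any two `H`-structures with `L`-equivalent reducts are equivalent in `L_H`
(`IsHStructure.elementarilyEquivalent`). The argument is a back-and-forth between finite tuples over
which the predicates are independent, with each extension step realized in an ultrapower. Exchange
for algebraic closure is never invoked: density of the predicate takes its place
(`IndepOver.insert_of_notMem_acl`). -/

namespace HStruct

open FirstOrder.Language FirstOrder.Language.Theory Set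

/-! ### Counting solutions by first-order formulas -/

section Counting

variable {L : FirstOrder.Language.{u, v}} {M : Type w} [L.Structure M] {α β : Type}

theorem mem_solutions {φ : L.Formula (α ⊕ Unit)} {a : α → M} {x : M} :
    x ∈ solutions φ a ↔ φ.Realize (Sum.elim a fun _ => x) := Iff.rfl

theorem solutions_relabel (g : β → α) (φ : L.Formula (β ⊕ Unit)) (a : α → M) :
    solutions (φ.relabel (Sum.map g id)) a = solutions φ (a ∘ g) := by
  ext x
  simp only [mem_solutions, Formula.realize_relabel]
  rw [Sum.elim_comp_map]; rfl

theorem solutions_inf (φ ψ : L.Formula (α ⊕ Unit)) (a : α → M) :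
    solutions (φ ⊓ ψ) a = solutions φ a ∩ solutions ψ a := by
  ext x
  simp [mem_solutions]

/-- The formula stating that `φ` has at least `k` solutions in its last variable. -/
noncomputable def atLeast (k : ℕ) (φ : L.Formula (α ⊕ Unit)) : L.Formula α :=
  Formula.iExs (Fin k)
    ((Formula.iInf fun i : Fin k => φ.relabel (Sum.map id fun _ => i)) ⊓
      Formula.iInf fun p : {p : Fin k × Fin k // p.1 ≠ p.2} =>
        ∼((Term.var (Sum.inr p.1.1)).equal (Term.var (Sum.inr p.1.2))))

theorem realize_atLeast {k : ℕ} {φ : L.Formula (α ⊕ Unit)} {a : α → M} :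
    (atLeast k φ).Realize a ↔ (k : ℕ∞) ≤ (solutions φ a).encard := by
  have key : (atLeast k φ).Realize a ↔
      ∃ x : Fin k → M, (∀ i, x i ∈ solutions φ a) ∧ Function.Injective x := by
    simp only [atLeast, Formula.realize_iExs, Formula.realize_inf, Formula.realize_iInf,
      Formula.realize_relabel, Formula.realize_not, Formula.realize_equal, Term.realize_var,
      Sum.elim_comp_map, mem_solutions]
    refine exists_congr fun x => and_congr Iff.rfl ⟨fun h i j hij => ?_, fun h p hp => p.2 (h hp)⟩
    by_contra hne
    exact h ⟨(i, j), hne⟩ hij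
  rw [key]
  constructor
  · rintro ⟨x, hx, hinj⟩
    calc (k : ℕ∞) = (range x).encard := by
          rw [← image_univ, hinj.encard_image, encard_univ]; simp
      _ ≤ _ := encard_le_encard (by rintro _ ⟨i, rfl⟩; exact hx i)
  · intro h
    obtain ⟨t, ht, htk⟩ := exists_subset_encard_eq h
    have hfin : t.Finite := finite_of_encard_eq_coe htk
    have : Nat.card t = k := by
      have := hfin.cast_ncard_eq
      rw [htk] at this
      rw [Nat.card_coe_set_eq]
      exact_mod_cast this
    have := hfin.to_subtype
    let e := (Finite.equivFinOfCardEq ‹Nat.card t = k›).symm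
    exact ⟨fun i => e i, fun i => ht (e i).2, Subtype.val_injective.comp e.injective⟩

theorem infinite_iff_forall_atLeast {φ : L.Formula (α ⊕ Unit)} {a : α → M} :
    (solutions φ a).Infinite ↔ ∀ k, (atLeast k φ).Realize a := by
  simp only [realize_atLeast]
  rw [← encard_eq_top_iff, ENat.eq_top_iff_forall_ge]

theorem finite_iff_exists_lt {s : Set M} : s.Finite ↔ ∃ k : ℕ, s.encard < k := by
  rw [← encard_lt_top_iff]
  constructor
  · intro h
    obtain ⟨n, hn⟩ := ENat.ne_top_iff_exists.1 h.ne
    exact ⟨n + 1, by rw [← hn]; exact_mod_cast Nat.lt_succ_self n⟩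
  · rintro ⟨k, hk⟩
    exact hk.trans (ENat.natCast_lt_top k)

end Counting

/-! ### Algebraic closure -/

section Acl

variable (L : FirstOrder.Language.{u, v}) {M : Type w} [L.Structure M]

/-- The algebraic closure of `A`. -/
def acl (A : Set M) : Set M :=
  {x | ∃ (ι : Type) (_ : Finite ι) (a : ι → M) (ψ : L.Formula (ι ⊕ Unit)),
    (∀ i, a i ∈ A) ∧ (solutions ψ a).Finite ∧ x ∈ solutions ψ a}

variable {L}

theorem acl_mono {A B : Set M} (h : A ⊆ B) : acl L A ⊆ acl L B :=
  fun _ ⟨ι, hι, a, ψ, ha, hψ⟩ => ⟨ι, hι, a, ψ, fun i => h (ha i), hψ⟩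

theorem subset_acl (A : Set M) : A ⊆ acl L A := by
  intro x hx
  have : solutions (L := L) ((Term.var (Sum.inl ())).equal (Term.var (Sum.inr ())))
      (fun _ : Unit => x) = {x} := by
    ext y
    simp [mem_solutions, eq_comm]
  exact ⟨Unit, inferInstance, fun _ => x,
    (Term.var (Sum.inl ())).equal (Term.var (Sum.inr ())), fun _ => hx, by simp [this], by simp [this]⟩

theorem exists_finite_of_mem_acl {A : Set M} {x : M} (hx : x ∈ acl L A) :
    ∃ F ⊆ A, F.Finite ∧ x ∈ acl L F := by
  obtain ⟨ι, hι, a, ψ, ha, hψ⟩ := hx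
  exact ⟨range a, by rintro _ ⟨i, rfl⟩; exact ha i, finite_range a,
    ι, hι, a, ψ, fun i => mem_range_self i, hψ⟩

theorem mem_acl_range_union {ι : Type} {a : ι → M} {B : Set M} {x : M}
    (hx : x ∈ acl L (range a ∪ B)) :
    ∃ (β : Type) (_ : Finite β) (b : β → M) (ψ : L.Formula ((ι ⊕ β) ⊕ Unit)),
      (∀ i, b i ∈ B) ∧ (solutions ψ (Sum.elim a b)).Finite ∧ x ∈ solutions ψ (Sum.elim a b) := by
  classical
  obtain ⟨γ, hγ, c, ψ, hc, hψ⟩ := hx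
  let g : γ → ι ⊕ {i // c i ∉ range a} := fun i =>
    if h : c i ∈ range a then Sum.inl h.choose else Sum.inr ⟨i, h⟩
  have hg : Sum.elim a (fun i : {i // c i ∉ range a} => c i) ∘ g = c := by
    funext i
    by_cases h : c i ∈ range a
    · simp only [Function.comp, g, dif_pos h, Sum.elim_inl]
      exact h.choose_spec
    · simp only [Function.comp, g, dif_neg h, Sum.elim_inr]
  refine ⟨{i // c i ∉ range a}, inferInstance, fun i => c i, ψ.relabel (Sum.map g id),
    fun i => (hc i).resolve_left i.2, ?_⟩
  rw [solutions_relabel, hg]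
  exact hψ

/-- A finite union of finite sets is finite: `c` is quantified over the finitely many solutions of
its algebraic formula. Other solutions `y` could make `ψ(y, b)` infinite, so `θ` also demands fewer
than `k` solutions. -/
theorem mem_acl_of_mem_acl_insert {A : Set M} {c x : M} (hc : c ∈ acl L A)
    (hx : x ∈ acl L (insert c A)) : x ∈ acl L A := by
  obtain ⟨ι, hι, a, χ, ha, hχ, hcχ⟩ := hc
  have : insert c A = range (fun _ : Unit => c) ∪ A := by rw [range_const, insert_eq]
  rw [this] at hx
  obtain ⟨β, hβ, b, ψ, hb, hψ, hxψ⟩ := mem_acl_range_union hx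
  obtain ⟨k, hk⟩ := finite_iff_exists_lt.1 hψ
  let θ : L.Formula ((ι ⊕ β) ⊕ Unit) := Formula.iExs Unit
    (χ.relabel (Sum.map (Sum.inl ∘ Sum.inl) id) ⊓
      ψ.relabel (Sum.elim (Sum.elim Sum.inr (Sum.inl ∘ Sum.inl ∘ Sum.inr)) (Sum.inl ∘ Sum.inr)) ⊓
      ∼((atLeast k ψ).relabel (Sum.elim Sum.inr (Sum.inl ∘ Sum.inl ∘ Sum.inr))))
  have hθ : ∀ z, z ∈ solutions θ (Sum.elim a b) ↔ ∃ y ∈ solutions χ a,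
      z ∈ solutions ψ (Sum.elim (fun _ => y) b) ∧
        (solutions ψ (Sum.elim (fun _ => y) b)).encard < k := by
    intro z
    rw [mem_solutions]
    simp only [θ, Formula.realize_iExs, Formula.realize_inf, Formula.realize_relabel,
      Formula.realize_not, realize_atLeast, not_le, mem_solutions]
    have e1 : ∀ y : Unit → M, (Sum.elim (Sum.elim (Sum.elim a b) fun _ : Unit => z) y) ∘
        (Sum.map (Sum.inl ∘ Sum.inl) id) = Sum.elim a fun _ => y () := by
      intro y; funext i; rcases i with i | i <;> rfl
    have e2 : ∀ y : Unit → M, (Sum.elim (Sum.elim (Sum.elim a b) fun _ : Unit => z) y) ∘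
        (Sum.elim (Sum.elim Sum.inr (Sum.inl ∘ Sum.inl ∘ Sum.inr)) (Sum.inl ∘ Sum.inr)) =
        Sum.elim (Sum.elim (fun _ : Unit => y ()) b) (fun _ : Unit => z) := by
      intro y; funext i; rcases i with (i | i) | i <;> rfl
    have e3 : ∀ y : Unit → M, (Sum.elim (Sum.elim (Sum.elim a b) fun _ : Unit => z) y) ∘
        (Sum.elim Sum.inr (Sum.inl ∘ Sum.inl ∘ Sum.inr)) =
        Sum.elim (fun _ : Unit => y ()) b := by
      intro y; funext i; rcases i with i | i <;> rfl
    simp only [e1, e2, e3]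
    constructor
    · rintro ⟨y, ⟨h1, h2⟩, h3⟩
      exact ⟨y (), h1, h2, h3⟩
    · rintro ⟨y, h1, h2, h3⟩
      exact ⟨fun _ => y, ⟨h1, h2⟩, h3⟩
  refine ⟨ι ⊕ β, inferInstance, Sum.elim a b, θ, by rintro (i | i); exacts [ha i, hb i], ?_,
    (hθ x).2 ⟨c, hcχ, hxψ, hk⟩⟩
  refine (hχ.biUnion (t := fun y => {z | z ∈ solutions ψ (Sum.elim (fun _ => y) b) ∧
    (solutions ψ (Sum.elim (fun _ => y) b)).encard < k}) fun y _ => ?_).subset fun z hz => ?_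
  · by_cases h : (solutions ψ (Sum.elim (fun _ => y) b)).encard < k
    · exact (finite_iff_exists_lt.2 ⟨k, h⟩).subset fun z hz => hz.1
    · exact finite_empty.subset fun z hz => (h hz.2).elim
  · obtain ⟨y, hy, hz⟩ := (hθ z).1 hz
    exact mem_biUnion hy hz

theorem acl_union_subset {A F : Set M} (hF : F ⊆ acl L A) : acl L (A ∪ F) ⊆ acl L A := by
  intro x hx
  obtain ⟨S, hS, hfin, hxS⟩ := exists_finite_of_mem_acl hx
  have key : ∀ G : Set M, G.Finite → G ⊆ acl L A → acl L (A ∪ G) ⊆ acl L A := by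
    intro G hG
    induction G, hG using Set.Finite.induction_on with
    | empty => intro _; simp
    | @insert c G _ _ ih =>
      intro h y hy
      refine ih ((subset_insert _ _).trans h) ?_
      rw [union_insert] at hy
      exact mem_acl_of_mem_acl_insert (acl_mono subset_union_left (h (mem_insert _ _))) hy
  refine key S hfin (hS.trans (union_subset (subset_acl A) hF)) (acl_mono subset_union_right hxS)

theorem acl_subset_of_subset_acl {A B : Set M} (h : B ⊆ acl L A) : acl L B ⊆ acl L A :=
  (acl_mono subset_union_right).trans (acl_union_subset h)

end Acl

/-! ### Independence of the predicate over a base -/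

section Independence

variable {L : FirstOrder.Language.{u, v}} {M : Type w} [L.Structure M]

/-- Every infinite set definable with parameters meets `D`. -/
def IsDense (L : FirstOrder.Language.{u, v}) {M : Type w} [L.Structure M] (D : Set M) : Prop :=
  ∀ (ι : Type) [Finite ι] (φ : L.Formula (ι ⊕ Unit)) (a : ι → M),
    (solutions φ a).Infinite → ∃ x ∈ D, x ∈ solutions φ a

/-- The elements of `D` outside `A` are algebraically independent over `A`. -/
def IndepOver (L : FirstOrder.Language.{u, v}) {M : Type w} [L.Structure M] (D A : Set M) : Prop :=
  ∀ h ∈ D, h ∉ A → h ∉ acl L (A ∪ D \ {h})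

theorem IsDense.mono {D D' : Set M} (h : IsDense L D) (hD : D ⊆ D') : IsDense L D' :=
  fun ι _ φ a hφ => let ⟨x, hx, hx'⟩ := h ι φ a hφ; ⟨x, hD hx, hx'⟩

theorem exists_solutions_eq_diff {α : Type} (φ : L.Formula (α ⊕ Unit)) {S : Set M}
    (hS : S.Finite) : ∃ (β : Type) (_ : Finite β) (b : β → M) (ψ : L.Formula ((α ⊕ β) ⊕ Unit)),
      range b = S ∧ ∀ a, solutions ψ (Sum.elim a b) = solutions φ a \ S := by
  obtain ⟨n, e, rfl⟩ := hS.fin_embedding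
  refine ⟨Fin n, inferInstance, e, φ.relabel (Sum.map Sum.inl id) ⊓
    Formula.iInf fun i => ∼((Term.var (Sum.inl (Sum.inr i))).equal (Term.var (Sum.inr ()))), rfl, fun a => ?_⟩
  rw [solutions_inf, solutions_relabel]
  ext x
  simp [mem_solutions, Sum.elim_comp_inl]

theorem IsDense.exists_notMem {D : Set M} (h : IsDense L D) {ι : Type} [Finite ι]
    {φ : L.Formula (ι ⊕ Unit)} {a : ι → M} (hφ : (solutions φ a).Infinite) {S : Set M}
    (hS : S.Finite) : ∃ x ∈ D, x ∈ solutions φ a ∧ x ∉ S := by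
  obtain ⟨β, _, b, ψ, -, hψ⟩ := exists_solutions_eq_diff φ hS
  obtain ⟨x, hx, hxψ⟩ := h _ ψ (Sum.elim a b) (by rw [hψ]; exact hφ.sdiff hS)
  rw [hψ] at hxψ
  exact ⟨x, hx, hxψ⟩

theorem IndepOver.union {D A F : Set M} (h : IndepOver L D A) (hF : F ⊆ D) :
    IndepOver L D (A ∪ F) := by
  intro x hx hxA hxacl
  rw [mem_union, not_or] at hxA
  refine h x hx hxA.1 (acl_mono ?_ hxacl)
  rintro y ((hy | hy) | hy)
  · exact Or.inl hy
  · exact Or.inr ⟨hF hy, by rintro rfl; exact hxA.2 hy⟩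
  · exact Or.inr hy

theorem IndepOver.insert_of_mem_acl {D A : Set M} {c : M} (h : IndepOver L D A)
    (hc : c ∈ acl L A) : IndepOver L D (insert c A) := by
  intro x hx hxA hxacl
  rw [insert_union] at hxacl
  exact h x hx (fun h => hxA (mem_insert_of_mem _ h))
    (mem_acl_of_mem_acl_insert (acl_mono subset_union_left hc) hxacl)

/-- A substitute for exchange. Suppose `x` is algebraic over `c` and `b`, and consider the `y` that
could replace `c` in witnessing this. If there are finitely many, `c` is algebraic over `A ∪ D`. If
infinitely many, density puts one different from `x` into `D`, and `x` depends on the rest of `D`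
over `A`. -/
theorem IndepOver.insert_of_notMem_acl {D A : Set M} {c : M} (h : IndepOver L D A)
    (hD : IsDense L D) (hc : c ∉ acl L (A ∪ D)) : IndepOver L D (insert c A) := by
  intro x hx hxA hxacl
  rw [insert_union, insert_eq, ← range_const (ι := Unit)] at hxacl
  obtain ⟨β, hβ, b, ψ, hb, hfin, hxψ⟩ := mem_acl_range_union hxacl
  obtain ⟨k, hk⟩ := finite_iff_exists_lt.1 hfin
  let θ : L.Formula ((β ⊕ Unit) ⊕ Unit) :=
    ψ.relabel (Sum.elim (Sum.elim Sum.inr (Sum.inl ∘ Sum.inl)) (Sum.inl ∘ Sum.inr)) ⊓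
      ∼((atLeast k ψ).relabel (Sum.elim Sum.inr (Sum.inl ∘ Sum.inl)))
  have hθ : ∀ y, y ∈ solutions θ (Sum.elim b fun _ => x) ↔
      x ∈ solutions ψ (Sum.elim (fun _ => y) b) ∧
        (solutions ψ (Sum.elim (fun _ => y) b)).encard < k := by
    intro y
    rw [mem_solutions]
    simp only [θ, Formula.realize_inf, Formula.realize_relabel, Formula.realize_not,
      realize_atLeast, not_le, mem_solutions]
    have e1 : (Sum.elim (Sum.elim b fun _ : Unit => x) fun _ : Unit => y) ∘
        (Sum.elim (Sum.elim Sum.inr (Sum.inl ∘ Sum.inl)) (Sum.inl ∘ Sum.inr)) =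
        Sum.elim (Sum.elim (fun _ : Unit => y) b) (fun _ : Unit => x) := by
      funext i; rcases i with (i | i) | i <;> rfl
    have e2 : (Sum.elim (Sum.elim b fun _ : Unit => x) fun _ : Unit => y) ∘
        (Sum.elim Sum.inr (Sum.inl ∘ Sum.inl)) = Sum.elim (fun _ : Unit => y) b := by
      funext i; rcases i with i | i <;> rfl
    rw [e1, e2]
  have hxA' : x ∉ A := fun h => hxA (mem_insert_of_mem _ h)
  have hsub : A ∪ D \ {x} ⊆ A ∪ D := union_subset_union_right _ sdiff_subset
  by_cases hinf : (solutions θ (Sum.elim b fun _ => x)).Infinite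
  · obtain ⟨y, hyD, hy, hyx⟩ := hD.exists_notMem hinf (finite_singleton x)
    obtain ⟨h1, h2⟩ := (hθ y).1 hy
    refine h x hx hxA' (acl_mono ?_ (⟨Unit ⊕ β, inferInstance, Sum.elim (fun _ => y) b, ψ, ?_,
      finite_iff_exists_lt.2 ⟨k, h2⟩, h1⟩ : x ∈ acl L (insert y (A ∪ D \ {x}))))
    · exact insert_subset (Or.inr ⟨hyD, hyx⟩) subset_rfl
    · rintro (i | i)
      exacts [mem_insert _ _, mem_insert_of_mem _ (hb i)]
  · refine hc ⟨β ⊕ Unit, inferInstance, Sum.elim b fun _ => x, θ, ?_, not_infinite.1 hinf,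
      (hθ c).2 ⟨hxψ, hk⟩⟩
    rintro (i | i)
    exacts [hsub (hb i), Or.inr hx]

/-- Elements of `A` are adjoined one at a time. One that is algebraic over the base and `D` uses
only finitely many elements of `D`, which are moved into the base first; any other is harmless by
`IndepOver.insert_of_notMem_acl`. -/
theorem IndepOver.exists_finite {D A : Set M} (h : IndepOver L D ∅) (hD : IsDense L D)
    (hA : A.Finite) : ∃ F ⊆ D, F.Finite ∧ IndepOver L D (A ∪ F) := by
  induction A, hA using Set.Finite.induction_on with
  | empty => exact ⟨∅, empty_subset _, finite_empty, by simpa using h⟩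
  | @insert c A _ _ ih =>
    obtain ⟨F, hF, hfin, hAF⟩ := ih
    by_cases hc : c ∈ acl L (A ∪ F ∪ D)
    · obtain ⟨S, hS, hSfin, hcS⟩ := exists_finite_of_mem_acl hc
      have hsub : S ⊆ A ∪ (F ∪ S ∩ D) := by
        intro y hy
        rcases hS hy with (h | h) | h
        · exact Or.inl h
        · exact Or.inr (Or.inl h)
        · exact Or.inr (Or.inr ⟨hy, h⟩)
      refine ⟨F ∪ S ∩ D, union_subset hF inter_subset_right, hfin.union (hSfin.inter_of_left D), ?_⟩
      have := hAF.union (inter_subset_right (s := S) (t := D))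
      rw [union_assoc] at this
      rw [insert_union]
      exact this.insert_of_mem_acl (acl_mono hsub hcS)
    · refine ⟨F, hF, hfin, ?_⟩
      rw [insert_union]
      exact hAF.insert_of_notMem_acl hD hc

end Independence

/-! ### Saturation for finite tuples -/

section Saturation

variable {L : FirstOrder.Language.{u, v}} {M : Type w} [L.Structure M] {κ : Cardinal.{w}}

theorem IsSaturated.exists_realize (hM : IsSaturated L M κ) (hκ : ℵ₀ ≤ κ) {α : Type} [Finite α]
    (c : α → M) (p : Set (L.Formula (α ⊕ Unit)))
    (hp : ∀ q ⊆ p, q.Finite → ∃ x, ∀ φ ∈ q, x ∈ solutions φ c) :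
    ∃ x, ∀ φ ∈ p, x ∈ solutions φ c := by
  let F : L.Formula (α ⊕ Unit) → L[[range c]].Formula Unit := fun φ =>
    BoundedFormula.constantsVarsEquiv.symm
      (φ.relabel (Sum.map (fun i => (⟨c i, mem_range_self i⟩ : range c)) id))
  have hF : ∀ φ x, (F φ).Realize (fun _ => x) ↔ x ∈ solutions φ c := by
    intro φ x
    rw [Formula.Realize, ← BoundedFormula.realize_constantsVarsEquiv, Equiv.apply_symm_apply,
      ← Formula.Realize, Formula.realize_relabel, Sum.elim_comp_map, mem_solutions]
    rfl
  obtain ⟨x, hx⟩ := hM (range c) (((finite_range c).lt_aleph0).trans_le hκ) (F '' p) (by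
    intro q hq hqp
    obtain ⟨q', hq'p, hq'fin, rfl⟩ := exists_subset_image_finite_and.1 ⟨q, hqp, hq, rfl⟩
    obtain ⟨x, hx⟩ := hp q' hq'p hq'fin
    refine ⟨x, ?_⟩
    rintro _ ⟨φ, hφ, rfl⟩
    exact (hF φ x).2 (hx φ hφ))
  exact ⟨x, fun φ hφ => (hF φ x).1 (hx _ (mem_image_of_mem F hφ))⟩

/-- Coordinates are realized one by one, each found coordinate joining the parameters `c`. Since the
sequence `θ` is decreasing, a finite part of the one-variable type follows from a single member. -/
theorem IsSaturated.exists_realize_fin (hM : IsSaturated L M κ) (hκ : ℵ₀ ≤ κ) (n : ℕ)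
    {α : Type} [Finite α] (c : α → M) (θ : ℕ → L.Formula (α ⊕ Fin n))
    (hθ : ∀ k v, (θ (k + 1)).Realize (M := M) v → (θ k).Realize v)
    (h : ∀ k, ∃ a, (θ k).Realize (Sum.elim c a)) : ∃ a, ∀ k, (θ k).Realize (Sum.elim c a) := by
  induction n generalizing α with
  | zero => exact ⟨Fin.elim0, fun k => by
      obtain ⟨a, ha⟩ := h k
      rwa [Subsingleton.elim Fin.elim0 a]⟩
  | succ n ih =>
    let g : α ⊕ Fin (n + 1) → (α ⊕ Unit) ⊕ Fin n :=
      Sum.elim (Sum.inl ∘ Sum.inl) (Fin.cases (Sum.inl (Sum.inr ())) Sum.inr)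
    have hg : ∀ (x : M) (b : Fin n → M), Sum.elim (Sum.elim c fun _ => x) b ∘ g =
        Sum.elim c (Fin.cons x b) := by
      intro x b
      funext i
      rcases i with i | i
      · rfl
      · refine Fin.cases ?_ (fun i => ?_) i <;> simp [g]
    have hmono : ∀ {j k : ℕ}, j ≤ k → ∀ v, (θ k).Realize (M := M) v → (θ j).Realize v := by
      intro j k hjk
      induction hjk with
      | refl => exact fun v h => h
      | step _ ih => exact fun v h => ih v (hθ _ v h)
    let χ : ℕ → L.Formula (α ⊕ Unit) := fun k => Formula.iExs (Fin n) ((θ k).relabel g)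
    have hχ : ∀ k x, x ∈ solutions (χ k) c ↔ ∃ b, (θ k).Realize (Sum.elim c (Fin.cons x b)) := by
      intro k x
      simp only [mem_solutions, χ, Formula.realize_iExs, Formula.realize_relabel, hg]
    obtain ⟨x, hx⟩ := hM.exists_realize hκ c (range χ) (by
      intro q hq hqfin
      obtain ⟨s, -, hsfin, rfl⟩ := exists_subset_image_finite_and.1
        ⟨q, by rwa [image_univ], hqfin, rfl⟩
      obtain ⟨N, hN⟩ := hsfin.bddAbove
      obtain ⟨a, ha⟩ := h N
      refine ⟨a 0, ?_⟩
      rintro _ ⟨k, hk, rfl⟩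
      refine (hχ k (a 0)).2 ⟨Fin.tail a, ?_⟩
      rw [Fin.cons_self_tail]
      exact hmono (hN hk) _ ha)
    obtain ⟨b, hb⟩ := ih (Sum.elim c fun _ => x) (fun k => (θ k).relabel g)
      (fun k v hv => by
        rw [Formula.realize_relabel] at hv ⊢
        exact hθ k _ hv)
      (fun k => by
        obtain ⟨b, hb⟩ := (hχ k x).1 (hx _ (mem_range_self k))
        exact ⟨b, by rwa [Formula.realize_relabel, hg]⟩)
    refine ⟨Fin.cons x b, fun k => ?_⟩
    have := hb k
    rwa [Formula.realize_relabel, hg] at this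

theorem IsSaturated.exists_realize_tuple (hM : IsSaturated L M κ) (hκ : ℵ₀ ≤ κ)
    {α : Type} [Finite α] (θ : ℕ → L.Formula α)
    (hθ : ∀ k v, (θ (k + 1)).Realize (M := M) v → (θ k).Realize v)
    (h : ∀ k, ∃ a : α → M, (θ k).Realize a) : ∃ a : α → M, ∀ k, (θ k).Realize a := by
  obtain ⟨n, ⟨e⟩⟩ := Finite.exists_equiv_fin α
  have key : ∀ (k : ℕ) (a : Fin n → M),
      ((θ k).relabel (Sum.inr ∘ e : α → Empty ⊕ Fin n)).Realize (Sum.elim Empty.elim a) ↔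
        (θ k).Realize (a ∘ e) := fun k a => by
    rw [Formula.realize_relabel]; rfl
  obtain ⟨a, ha⟩ := hM.exists_realize_fin hκ n (Empty.elim : Empty → M)
    (fun k => (θ k).relabel (Sum.inr ∘ e)) (fun k v hv => by
      rw [Formula.realize_relabel] at hv ⊢
      exact hθ k _ hv) (fun k => by
      obtain ⟨a, ha⟩ := h k
      refine ⟨a ∘ e.symm, (key k _).2 ?_⟩
      simpa [Function.comp_assoc] using ha)
  exact ⟨a ∘ e, fun k => (key k a).1 (ha k)⟩

end Saturation

/-! ### Formulas about the predicate, and uniform density -/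

section Predicate

variable {L : FirstOrder.Language.{u, v}}

/-- The relation symbol `H`. -/
def symH : (langH L).Relations 1 :=
  let R : predLang.Relations 1 := PredRel.H
  Sum.inr R

/-- The formula `H(x)` for a variable `x`. -/
def inH {α : Type w'} (x : α) : (langH L).Formula α :=
  Relations.formula₁ symH (Term.var x)

/-- An `L`-formula viewed as an `L_H`-formula. -/
def lift {α : Type w'} (φ : L.Formula α) : (langH L).Formula α :=
  (LHom.sumInl : L →ᴸ langH L).onFormula φ

/-- The `L_H`-structure `M` expands the `L`-structure `M` by the predicate `D`. -/
class IsPredExpansion (L : FirstOrder.Language.{u, v}) {M : Type w} [L.Structure M]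
    [(langH L).Structure M] (D : Set M) : Prop where
  isExpansionOn : (LHom.sumInl : L →ᴸ langH L).IsExpansionOn M
  relMap_symH : ∀ x : Fin 1 → M, Structure.RelMap (symH : (langH L).Relations 1) x ↔ x 0 ∈ D

instance {M : Type w} [L.Structure M] (D : Set M) :
    IsPredExpansion L (M := Expansion D) (show Set (Expansion D) from D) where
  isExpansionOn := inferInstance
  relMap_symH := fun _ => Iff.rfl

variable {M : Type w} [L.Structure M] [(langH L).Structure M] {α : Type}

theorem realize_lift (D : Set M) [IsPredExpansion L D] {φ : L.Formula α} {v : α → M} : (lift φ).Realize v ↔ φ.Realize v :=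
  have := IsPredExpansion.isExpansionOn (L := L) (D := D)
  LHom.realize_onFormula _ φ

theorem realize_inH (D : Set M) [IsPredExpansion L D] {x : α} {v : α → M} : (inH (L := L) x).Realize v ↔ v x ∈ D := by
  rw [inH, Formula.realize_rel₁, IsPredExpansion.relMap_symH (L := L) (D := D)]
  rfl

variable {κ : Cardinal.{w}} {D : Set M} [IsPredExpansion L D]

/-- Compactness in the expanded language: without a bound, saturation yields one tuple whose
solution set is infinite and misses `D`. -/
theorem IsDense.exists_uniform (hD : IsDense L D) (hκ : ℵ₀ ≤ κ)
    (hM : IsSaturated (langH L) M κ) {α : Type} [Finite α] (φ : L.Formula (α ⊕ Unit)) :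
    ∃ N : ℕ, ∀ a : α → M, (N : ℕ∞) ≤ (solutions φ a).encard → ∃ x ∈ D, x ∈ solutions φ a := by
  by_contra! hcon
  let θ : ℕ → (langH L).Formula α := fun k => lift (atLeast k φ) ⊓
    ∼(Formula.iExs Unit (inH (Sum.inr ()) ⊓ lift φ))
  have hθ : ∀ k (a : α → M), (θ k).Realize a ↔
      (k : ℕ∞) ≤ (solutions φ a).encard ∧ ∀ x ∈ D, x ∉ solutions φ a := by
    intro k a
    simp only [θ, Formula.realize_inf, Formula.realize_not, Formula.realize_iExs,
      realize_lift D, realize_inH D, realize_atLeast]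
    refine and_congr Iff.rfl ?_
    rw [not_exists]
    constructor
    · intro h x hx hxφ
      exact h (fun _ => x) ⟨hx, hxφ⟩
    · intro h x hx
      exact h (x ()) hx.1 hx.2
  obtain ⟨a, ha⟩ := hM.exists_realize_tuple hκ θ (fun k v hv => by
    rw [hθ] at hv ⊢
    exact ⟨le_trans (by exact_mod_cast Nat.le_succ k) hv.1, hv.2⟩) (fun k => by
    obtain ⟨a, ha⟩ := hcon k
    exact ⟨a, (hθ k a).2 ha⟩)
  obtain ⟨x, hx, hxφ⟩ := hD α φ a
    (infinite_iff_forall_atLeast.2 fun k => realize_atLeast.2 ((hθ k a).1 (ha k)).1)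
  exact ((hθ 0 a).1 (ha 0)).2 x hx hxφ

end Predicate

/-! ### Definable closure lies in algebraic closure -/

section Dcl

variable {L : FirstOrder.Language.{u, v}} {M : Type w} [L.Structure M]

theorem dcl_subset_acl (A : Set M) : dcl L A ⊆ acl L A := by
  intro x hx
  change A.Definable L {v : Fin 1 → M | v 0 ∈ ({x} : Set M)} at hx
  rw [definable_iff_finitely_definable] at hx
  obtain ⟨A₀, hA₀, hx⟩ := hx
  rw [definable_iff_exists_formula_sum] at hx
  obtain ⟨φ, hφ⟩ := hx
  let e : Fin _ ≃ A₀ := A₀.equivFin.symm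
  have : solutions (φ.relabel (Sum.map e.symm fun _ => ())) (fun i => (e i).1) = {x} := by
    ext y
    have := congrArg (fun s => (fun _ => y) ∈ s) hφ
    simp only [mem_ofPred_eq] at this
    rw [mem_solutions, Formula.realize_relabel, this, Sum.elim_comp_map]
    have : (fun i => (e i).1) ∘ e.symm = (Subtype.val : ↥(A₀ : Set M) → M) := by
      funext i; simp
    rw [this]
    rfl
  exact ⟨_, inferInstance, _, _, fun i => hA₀ (e i).2, by rw [this]; exact finite_singleton x,
    by rw [this]; rfl⟩

end Dcl

/-! ### Algebraic and definable closure agree in the presence of an order -/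

section Order

variable {L : FirstOrder.Language.{u, v}} [L.IsOrdered] {M : Type w} [L.Structure M]
  [LinearOrder M] [L.OrderedStructure M] {α : Type}

/-- The formula `x < y` for variables `x` and `y`. -/
def ltF (x y : α) : L.Formula α :=
  ∼(Relations.formula₂ (leSymb : L.Relations 2) (Term.var y) (Term.var x))

theorem realize_ltF {x y : α} {a : α → M} : (ltF (L := L) x y).Realize a ↔ a x < a y := by
  simp [ltF, Formula.realize_rel₂]

/-- The formula stating that `x` is a solution of `φ` and that exactly `i` solutions of `φ` are
smaller than `x`. -/
noncomputable def rankF (i : ℕ) (φ : L.Formula (α ⊕ Unit)) : L.Formula (α ⊕ Unit) :=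
  φ ⊓ (atLeast i (φ.relabel (Sum.map Sum.inl id) ⊓ ltF (Sum.inr ()) (Sum.inl (Sum.inr ())))) ⊓
    ∼(atLeast (i + 1)
      (φ.relabel (Sum.map Sum.inl id) ⊓ ltF (Sum.inr ()) (Sum.inl (Sum.inr ()))))

theorem solutions_below {φ : L.Formula (α ⊕ Unit)} {a : α → M} {x : M} :
    solutions (φ.relabel (Sum.map Sum.inl id) ⊓ ltF (Sum.inr ()) (Sum.inl (Sum.inr ())))
      (Sum.elim a fun _ : Unit => x) = solutions φ a ∩ Iio x := by
  rw [solutions_inf, solutions_relabel, Sum.elim_comp_inl]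
  congr 1
  ext y
  simp [mem_solutions, realize_ltF]

theorem mem_solutions_rankF {i : ℕ} {φ : L.Formula (α ⊕ Unit)} {a : α → M} {x : M} :
    x ∈ solutions (rankF i φ) a ↔ x ∈ solutions φ a ∧ (solutions φ a ∩ Iio x).encard = i := by
  rw [rankF, solutions_inf, solutions_inf, mem_inter_iff, mem_inter_iff, and_assoc]
  refine and_congr Iff.rfl ?_
  rw [mem_solutions, mem_solutions, Formula.realize_not, realize_atLeast, realize_atLeast,
    solutions_below, not_le, Nat.cast_add, Nat.cast_one, ENat.lt_add_one_iff (ENat.natCast_ne_top i)]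
  exact ⟨fun h => le_antisymm h.2 h.1, fun h => ⟨h.ge, h.le⟩⟩

theorem solutions_rankF_subsingleton (i : ℕ) (φ : L.Formula (α ⊕ Unit)) (a : α → M) :
    (solutions (rankF i φ) a).Subsingleton := by
  have key : ∀ x ∈ solutions (rankF i φ) a, ∀ y ∈ solutions (rankF i φ) a, ¬x < y := by
    intro x hx y hy hxy
    rw [mem_solutions_rankF] at hx hy
    have hfin : (solutions φ a ∩ Iio x).Finite := finite_of_encard_eq_coe hx.2
    have : solutions φ a ∩ Iio x ⊂ solutions φ a ∩ Iio y :=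
      ⟨fun z hz => ⟨hz.1, lt_trans hz.2 hxy⟩, fun h => lt_irrefl x (h ⟨hx.1, hxy⟩).2⟩
    have := hfin.encard_lt_encard this
    rw [hx.2, hy.2] at this
    exact lt_irrefl _ this
  intro x hx y hy
  exact le_antisymm (not_lt.1 (key y hy x hx)) (not_lt.1 (key x hx y hy))

theorem exists_encard_inter_Iio_eq {S : Set M} (hS : S.Finite) {i : ℕ} (hi : i < S.encard) :
    ∃ x ∈ S, (S ∩ Iio x).encard = i := by
  lift S to Finset M using hS
  rw [encard_coe_eq_coe_finsetCard] at hi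
  have hi : i < S.card := by exact_mod_cast hi
  let e := S.orderEmbOfFin rfl
  refine ⟨e ⟨i, hi⟩, S.orderEmbOfFin_mem rfl _, ?_⟩
  have : (S : Set M) ∩ Iio (e ⟨i, hi⟩) = e '' (Finset.Iio (⟨i, hi⟩ : Fin S.card) : Set _) := by
    ext x
    constructor
    · rintro ⟨hx, hlt⟩
      rw [← S.range_orderEmbOfFin rfl] at hx
      obtain ⟨j, rfl⟩ := hx
      exact ⟨j, by simpa using (e.lt_iff_lt.1 hlt), rfl⟩
    · rintro ⟨j, hj, rfl⟩
      exact ⟨S.orderEmbOfFin_mem rfl j, e.lt_iff_lt.2 (by simpa using hj)⟩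
  rw [this, e.injective.encard_image, encard_coe_eq_coe_finsetCard, Fin.card_Iio]

/-- An element of a finite definable set is singled out by its position in the order. -/
theorem acl_subset_dcl (A : Set M) : acl L A ⊆ dcl L A := by
  rintro x ⟨ι, hι, a, ψ, ha, hfin, hx⟩
  obtain ⟨i, hi⟩ := ENat.ne_top_iff_exists.1
    (encard_ne_top_iff.2 (hfin.inter_of_left (Iio x)))
  have hx' : x ∈ solutions (rankF i ψ) a := mem_solutions_rankF.2 ⟨hx, hi.symm⟩
  have hx'' := (solutions_rankF_subsingleton i ψ a).eq_singleton_of_mem hx'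
  change A.Definable L {v : Fin 1 → M | v 0 ∈ ({x} : Set M)}
  rw [definable_iff_exists_formula_sum]
  refine ⟨(rankF i ψ).relabel (Sum.map (fun i => ⟨a i, ha i⟩) fun _ => 0), ?_⟩
  ext v
  rw [← hx'', mem_ofPred_eq, mem_ofPred_eq, Formula.realize_relabel, Sum.elim_comp_map]
  rfl

theorem acl_eq_dcl (A : Set M) : acl L A = dcl L A :=
  (acl_subset_dcl A).antisymm (dcl_subset_acl A)

end Order

/-! ### Uniform finiteness from density and independence -/

section UniformFiniteness

variable {L : FirstOrder.Language.{u, v}} {M : Type w} [L.Structure M]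

/-- For every formula there is a bound on the sizes of the finite sets that it defines. -/
def UniformFinite (L : FirstOrder.Language.{u, v}) (M : Type w) [L.Structure M] : Prop :=
  ∀ (ι : Type) [Finite ι] (φ : L.Formula (ι ⊕ Unit)), ∃ N : ℕ, ∀ a : ι → M,
    (N : ℕ∞) ≤ (solutions φ a).encard → (solutions φ a).Infinite

variable [(langH L).Structure M] {κ : Cardinal.{w}} {D : Set M} [IsPredExpansion L D]
  [L.IsOrdered] [LinearOrder M] [L.OrderedStructure M]

/-- If finite solution sets were unbounded in size, saturation would give one `a` whose solution set
has an element of every finite rank. Large finite initial segments of it meet `D` by uniform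
density, yet all their elements are definable over `a`, against independence over a finite base
containing `a`. -/
theorem IsDense.uniformFinite (hD : IsDense L D) (hind : IndepOver L D ∅) (hκ : ℵ₀ ≤ κ)
    (hM : IsSaturated (langH L) M κ) : UniformFinite L M := by
  intro ι _ φ
  by_contra! hcon
  let θ : ℕ → L.Formula ι := fun k => Formula.iInf fun i : Fin k => atLeast 1 (rankF i φ)
  have hθ : ∀ k (a : ι → M), (θ k).Realize a ↔ ∀ i < k, ∃ x, x ∈ solutions (rankF i φ) a := by
    intro k a
    simp only [θ, Formula.realize_iInf, realize_atLeast, Nat.cast_one, one_le_encard_iff_nonempty]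
    exact ⟨fun h i hi => h ⟨i, hi⟩, fun h i => h i i.2⟩
  obtain ⟨a, ha⟩ := hM.exists_realize_tuple hκ (fun k => lift (θ k)) (fun k v hv => by
    rw [realize_lift D, hθ] at hv ⊢
    exact fun i hi => hv i (Nat.lt_succ_of_lt hi)) (fun k => by
    obtain ⟨a, hka, hfin⟩ := hcon k
    refine ⟨a, (realize_lift D).2 ((hθ k a).2 fun i hi => ?_)⟩
    obtain ⟨x, hx, hxi⟩ := exists_encard_inter_Iio_eq hfin
      (lt_of_lt_of_le (by exact_mod_cast hi) hka)
    exact ⟨x, mem_solutions_rankF.2 ⟨hx, hxi⟩⟩)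
  have ha : ∀ i, ∃ x, x ∈ solutions (rankF i φ) a := fun i =>
    (hθ (i + 1) a).1 ((realize_lift D).1 (ha (i + 1))) i (Nat.lt_succ_self i)
  obtain ⟨F, -, hFfin, hF⟩ := hind.exists_finite hD (finite_range a)
  have hT : (range a ∪ F).Finite := (finite_range a).union hFfin
  obtain ⟨β, _, b, ψ, -, hψ⟩ := exists_solutions_eq_diff (M := M)
    (φ.relabel (Sum.map Sum.inl id) ⊓ ltF (Sum.inr ()) (Sum.inl (Sum.inr ())) :
      L.Formula ((ι ⊕ Unit) ⊕ Unit)) hT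
  obtain ⟨N, hN⟩ := hD.exists_uniform hκ hM ψ
  -- With this rank, at least `N` solutions below `q` survive the removal of the finite base.
  obtain ⟨q, hq⟩ := ha (N + (range a ∪ F).ncard)
  rw [mem_solutions_rankF] at hq
  obtain ⟨h, hhD, hh⟩ := hN (Sum.elim (Sum.elim a fun _ => q) b) (by
    rw [hψ, solutions_below]
    have := encard_le_encard_sdiff_add_encard (solutions φ a ∩ Iio q) (range a ∪ F)
    rw [hq.2, ← hT.cast_ncard_eq, Nat.cast_add] at this
    exact (ENat.add_le_add_iff_right (ENat.natCast_ne_top _)).1 this)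
  rw [hψ, solutions_below] at hh
  have hfin : (solutions φ a ∩ Iio q).Finite := finite_of_encard_eq_coe hq.2
  have hfin' : (solutions φ a ∩ Iio h).Finite :=
    hfin.subset fun y hy => ⟨hy.1, lt_trans hy.2 hh.1.2⟩
  obtain ⟨i, hi⟩ := ENat.ne_top_iff_exists.1 (encard_ne_top_iff.2 hfin')
  refine hF h hhD hh.2 (acl_mono (subset_union_left.trans subset_union_left)
    ⟨ι, inferInstance, a, rankF i φ, mem_range_self, (solutions_rankF_subsingleton i φ a).finite,
      mem_solutions_rankF.2 ⟨hh.1.1, hi.symm⟩⟩)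

end UniformFiniteness

/-! ### Transfer along elementary equivalence -/

section Transfer

variable {L : FirstOrder.Language.{u, v}} {M : Type w} [L.Structure M] {N : Type w'} [L.Structure N]

theorem forall_realize_of_elementarilyEquivalent (h : L.ElementarilyEquivalent M N) {ι : Type}
    [Finite ι] {φ : L.Formula ι} (hφ : ∀ a : ι → M, φ.Realize a) (b : ι → N) : φ.Realize b := by
  let σ : L.Sentence := Formula.iAlls ι (φ.relabel (Sum.inr : ι → Empty ⊕ ι))
  have hM : M ⊨ σ := by
    change Formula.Realize _ _
    rw [Formula.realize_iAlls]
    intro a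
    rw [Formula.realize_relabel]
    exact hφ a
  have hN : N ⊨ σ := (elementarilyEquivalent_iff.1 h σ).1 hM
  change Formula.Realize _ _ at hN
  rw [Formula.realize_iAlls] at hN
  have := hN b
  rw [Formula.realize_relabel] at this
  exact this

theorem UniformFinite.of_elementarilyEquivalent (hM : UniformFinite L M)
    (h : L.ElementarilyEquivalent M N) : UniformFinite L N := by
  intro ι _ φ
  obtain ⟨k, hk⟩ := hM ι φ
  refine ⟨k, fun b hb => infinite_iff_forall_atLeast.2 fun m => ?_⟩
  have := forall_realize_of_elementarilyEquivalent h
    (φ := (atLeast k φ).imp (atLeast m φ)) (fun a => by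
      rw [Formula.realize_imp, realize_atLeast]
      exact fun ha => infinite_iff_forall_atLeast.1 (hk a ha) m) b
  rw [Formula.realize_imp] at this
  exact this (realize_atLeast.2 hb)

end Transfer

/-! ### Infinite definable sets contain intervals -/

section Intervals

variable {L : FirstOrder.Language.{u, v}} {M : Type w} [L.Structure M] [LinearOrder M]

theorem IsPointOrInterval.ordConnected {J : Set M} (h : IsPointOrInterval J) : J.OrdConnected := by
  rcases h with ⟨a, rfl⟩ | ⟨a, b, rfl⟩ | ⟨a, rfl⟩ | ⟨a, rfl⟩ | rfl
  exacts [ordConnected_singleton, ordConnected_Ioo, ordConnected_Iio, ordConnected_Ioi,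
    ordConnected_univ]

theorem IsOMinimal.exists_Ioo_subset (hM : IsOMinimal L M) {ι : Type} [Finite ι]
    {φ : L.Formula (ι ⊕ Unit)} {a : ι → M} (h : (solutions φ a).Infinite) :
    ∃ p q, p < q ∧ Ioo p q ⊆ solutions φ a := by
  obtain ⟨F, hF, hFJ, hs⟩ := hM (solutions φ a) (by
    change (univ : Set M).Definable L {v : Fin 1 → M | v 0 ∈ solutions φ a}
    rw [definable_iff_exists_formula_sum]
    refine ⟨φ.relabel (Sum.map (fun i => ⟨a i, mem_univ _⟩) fun _ => 0), ?_⟩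
    ext v
    rw [mem_ofPred_eq, mem_ofPred_eq, Formula.realize_relabel, Sum.elim_comp_map]
    rfl)
  rw [hs] at h ⊢
  obtain ⟨J, hJ, hJinf⟩ : ∃ J ∈ F, J.Infinite := by
    by_contra! hcon
    exact h (hF.sUnion fun J hJ => hcon J hJ)
  obtain ⟨p, hp, q, hq, hpq⟩ := hJinf.nontrivial.exists_lt
  exact ⟨p, q, hpq, (Ioo_subset_Icc_self.trans ((hFJ J hJ).ordConnected.out hp hq)).trans
    (subset_sUnion_of_mem hJ)⟩

variable [L.IsOrdered] [L.OrderedStructure M]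

/-- The formula stating that the set of solutions of `φ` contains an interval. -/
noncomputable def containsIoo {α : Type} (φ : L.Formula (α ⊕ Unit)) : L.Formula α :=
  Formula.iExs Bool (ltF (Sum.inr false) (Sum.inr true) ⊓
    Formula.iAlls Unit ((ltF (Sum.inl (Sum.inr false)) (Sum.inr ()) ⊓
      ltF (Sum.inr ()) (Sum.inl (Sum.inr true))).imp (φ.relabel (Sum.map Sum.inl id))))

theorem realize_containsIoo {α : Type} {φ : L.Formula (α ⊕ Unit)} {a : α → M} :
    (containsIoo φ).Realize a ↔ ∃ p q, p < q ∧ Ioo p q ⊆ solutions φ a := by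
  simp only [containsIoo, Formula.realize_iExs, Formula.realize_inf, realize_ltF,
    Formula.realize_iAlls, Formula.realize_imp, Formula.realize_relabel, Sum.elim_inr, Sum.elim_inl]
  constructor
  · rintro ⟨c, hc, h⟩
    refine ⟨c false, c true, hc, fun x hx => ?_⟩
    have := h (fun _ => x) hx
    rwa [Sum.elim_comp_map, Sum.elim_comp_inl] at this
  · rintro ⟨p, q, hpq, h⟩
    refine ⟨fun i => if i then q else p, by simpa using hpq, fun x hx => ?_⟩
    rw [Sum.elim_comp_map, Sum.elim_comp_inl]
    exact h (by simpa using hx)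

/-- Only some model `N` of `T` is known to be o-minimal. Uniform finiteness moves from `M` to `N`
and turns "infinite" into "at least `k` solutions", so that the interval property becomes
first-order and moves back. -/
theorem IsOMinimalTheory.exists_Ioo_subset {T : L.Theory}
    (hT : IsOMinimalTheory.{u, v, w'} T) (hM : M ⊨ T) [Nonempty M] (hfin : UniformFinite L M)
    {ι : Type} [Finite ι] {φ : L.Formula (ι ⊕ Unit)} {a : ι → M} (h : (solutions φ a).Infinite) :
    ∃ p q, p < q ∧ Ioo p q ⊆ solutions φ a := by
  obtain ⟨hcomp, N, _, _, _, _, _, hN, hNT⟩ := hT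
  have hMN : L.ElementarilyEquivalent M N := IsComplete.models_elementarily_equivalent hcomp M N
  obtain ⟨k, hk⟩ := hfin.of_elementarilyEquivalent hMN ι φ
  have := forall_realize_of_elementarilyEquivalent hMN.symm
    (φ := (atLeast k φ).imp (containsIoo φ)) (fun b => by
      rw [Formula.realize_imp, realize_atLeast, realize_containsIoo]
      exact fun hb => hN.exists_Ioo_subset (hk b hb)) a
  rw [Formula.realize_imp, realize_containsIoo] at this
  exact this (infinite_iff_forall_atLeast.1 h k)

theorem IsOMinimalTheory.denselyOrdered {T : L.Theory}
    (hT : IsOMinimalTheory.{u, v, w'} T) (hM : M ⊨ T) [Nonempty M] : DenselyOrdered M := by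
  obtain ⟨hcomp, N, _, _, _, _, _, hN, hNT⟩ := hT
  have hMN : L.ElementarilyEquivalent M N := IsComplete.models_elementarily_equivalent hcomp M N
  rw [← realize_denselyOrdered_iff (L := L), elementarilyEquivalent_iff.1 hMN,
    realize_denselyOrdered_iff]
  assumption

end Intervals

/-- The axioms of `H`-structures with algebraic closure, relative to a theory that eliminates the
quantifier "there are infinitely many". -/
structure IsHStructure (L : FirstOrder.Language.{u, v}) {M : Type w} [L.Structure M] (D : Set M) :
    Prop where
  uniformFinite : UniformFinite L M
  indep : IndepOver L D ∅
  dense : IsDense L D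
  extension : ∀ (ι β : Type) [Finite ι] [Finite β] (k : ℕ) (φ : L.Formula (ι ⊕ Unit))
    (ψ : L.Formula ((ι ⊕ β) ⊕ Unit)) (a : ι → M),
    (∀ y : β → M, (solutions ψ (Sum.elim a y)).encard < k) → (solutions φ a).Infinite →
      ∃ x ∈ solutions φ a, ∀ h : β → M, (∀ i, h i ∈ D) → x ∉ solutions ψ (Sum.elim a h)

/-! ### The axiom schemes in terms of algebraic closure -/

section ModelsIndep

variable {L : FirstOrder.Language.{u, v}} {M : Type w} [L.Structure M] {T : L.Theory} {D : Set M}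

theorem ModelsIndep.isDense (h : ModelsIndep T D) : IsDense L D := by
  intro ι _ φ a hφ
  obtain ⟨n, ⟨e⟩⟩ := Finite.exists_equiv_fin ι
  have : solutions (φ.relabel (Sum.map e id)) (a ∘ e.symm) = solutions φ a := by
    rw [solutions_relabel]
    simp [Function.comp_assoc]
  rw [← this] at hφ ⊢
  exact h.density n _ _ hφ

theorem ModelsIndep.indepOver (h : ModelsIndep T D) : IndepOver L D ∅ := by
  rintro x hx - ⟨ι, _, a, ψ, ha, hfin, hxψ⟩
  obtain ⟨n, ⟨e⟩⟩ := Finite.exists_equiv_fin ι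
  have : solutions (ψ.relabel (Sum.map e id)) (a ∘ e.symm) = solutions ψ a := by
    rw [solutions_relabel]
    simp [Function.comp_assoc]
  rw [← this] at hfin hxψ
  obtain ⟨k, hk⟩ := finite_iff_exists_lt.1 hfin
  have ha' : ∀ i, a i ∈ D ∧ a i ≠ x := fun i => by simpa using ha i
  exact h.independent n k _ _ x (fun i => (ha' _).1) hx (fun i => (ha' _).2.symm) hk hxψ

end ModelsIndep

/-! ### The extension axiom from the function `f` -/

section Extension

variable {L : FirstOrder.Language.{u, v}} [L.IsOrdered] {M : Type w} [L.Structure M]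
  [LinearOrder M] [L.OrderedStructure M] {D : Set M}

theorem IsDense.exists_mem_Ioo [DenselyOrdered M] (hD : IsDense L D) {p q : M} (hpq : p < q)
    {S : Set M} (hS : S.Finite) : ∃ x ∈ D, x ∈ Ioo p q ∧ x ∉ S := by
  have : solutions (ltF (L := L) (Sum.inl false) (Sum.inr ()) ⊓ ltF (Sum.inr ()) (Sum.inl true))
      (fun i : Bool => if i then q else p) = Ioo p q := by
    ext x
    simp [mem_solutions, realize_ltF]
  rw [← this]
  exact hD.exists_notMem (by rw [this]; exact Ioo_infinite hpq) hS

/-- The point is `z = f(x₁, f(x₂, …))` with distinct `xᵢ ∈ D`. The interval hypothesis, applied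
backwards, confines the inner arguments so that the value falls in `(p, q)`; at every level the two
arguments are recoverable from each other and the value, hence each `xᵢ` from `z` and the rest. -/
theorem IsDense.exists_interalgebraic [DenselyOrdered M] (hD : IsDense L D) {f : M → M → M}
    (hf : ∀ x y, f x y ∈ acl L {x, y}) (hf₁ : ∀ x y, x ∈ acl L {f x y, y})
    (hf₂ : ∀ x y, y ∈ acl L {f x y, x})
    (hint : ∀ a b : M, a < b → ∃ a' b' : M, a' < b' ∧
      ∀ x ∈ Ioo a' b', ∀ y ∈ Ioo a' b', f x y ∈ Ioo a b)
    (m : ℕ) {p q : M} (hpq : p < q) {S : Set M} (hS : S.Finite) :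
    ∃ G : Set M, G ⊆ D ∧ Disjoint G S ∧ G.encard = m + 1 ∧ ∃ z ∈ Ioo p q, z ∈ acl L G ∧
      ∀ g ∈ G, g ∈ acl L (insert z (G \ {g})) := by
  induction m generalizing p q with
  | zero =>
    obtain ⟨x, hx, hxpq, hxS⟩ := hD.exists_mem_Ioo hpq hS
    refine ⟨{x}, by simpa using hx, by simpa using hxS, by simp, x, hxpq,
      subset_acl _ rfl, ?_⟩
    rintro g rfl
    exact subset_acl _ (mem_insert _ _)
  | succ m ih =>
    obtain ⟨p', q', hpq', hf'⟩ := hint p q hpq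
    obtain ⟨G, hGD, hGS, hcard, z, hz, hzG, hg⟩ := ih hpq'
    have hGfin : G.Finite := finite_of_encard_eq_coe (k := m + 1) (by rw [hcard]; push_cast; rfl)
    obtain ⟨x, hx, hxpq, hxS⟩ := hD.exists_mem_Ioo hpq' (hS.union hGfin)
    rw [mem_union, not_or] at hxS
    refine ⟨insert x G, insert_subset hx hGD, disjoint_insert_left.2 ⟨hxS.1, hGS⟩, ?_, f x z,
      hf' x hxpq z hz, ?_, ?_⟩
    · rw [encard_insert_of_notMem hxS.2, hcard]
      simp
    · refine acl_subset_of_subset_acl ?_ (hf x z)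
      rintro y (rfl | rfl)
      · exact subset_acl _ (mem_insert _ _)
      · exact acl_mono (subset_insert _ _) hzG
    · rintro g (rfl | hgG)
      · refine acl_subset_of_subset_acl ?_ (hf₁ g z)
        rintro y (rfl | rfl)
        · exact subset_acl _ (mem_insert _ _)
        · refine acl_mono ?_ hzG
          intro y hy
          exact Or.inr ⟨Or.inr hy, by rintro rfl; exact hxS.2 hy⟩
      · have hxg : x ≠ g := by rintro rfl; exact hxS.2 hgG
        refine acl_subset_of_subset_acl ?_ (hg g hgG)
        rintro y (rfl | hy)
        · refine acl_mono ?_ (hf₂ x y)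
          rintro w (rfl | rfl)
          · exact Or.inl rfl
          · exact Or.inr ⟨Or.inl rfl, hxg⟩
        · exact subset_acl _ (Or.inr ⟨Or.inr hy.1, hy.2⟩)

/-- For extension, `z` is built from `|β| + 1` points of `D` off the base. A tuple `h` indexed by
`β` omits one of them, `g`. If `ψ(a, h)` captured `z`, then `z`, and with it `g`, would be algebraic
over the base and `D \ {g}`. This works even when `D` generates the whole structure. -/
theorem isHStructure_of_indepOver [DenselyOrdered M] (hfin : UniformFinite L M)
    (hIoo : ∀ (ι : Type) [Finite ι] (φ : L.Formula (ι ⊕ Unit)) (a : ι → M),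
      (solutions φ a).Infinite → ∃ p q, p < q ∧ Ioo p q ⊆ solutions φ a)
    (hD : IsDense L D) (hind : IndepOver L D ∅) {f : M → M → M}
    (hf : ∀ x y, f x y ∈ acl L {x, y}) (hf₁ : ∀ x y, x ∈ acl L {f x y, y})
    (hf₂ : ∀ x y, y ∈ acl L {f x y, x})
    (hint : ∀ a b : M, a < b → ∃ a' b' : M, a' < b' ∧
      ∀ x ∈ Ioo a' b', ∀ y ∈ Ioo a' b', f x y ∈ Ioo a b) : IsHStructure L D where
  uniformFinite := hfin
  indep := hind
  dense := hD
  extension := by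
    intro ι β _ _ k φ ψ a hψ hφ
    obtain ⟨p, q, hpq, hsub⟩ := hIoo ι φ a hφ
    obtain ⟨F, hFD, hFfin, hF⟩ := hind.exists_finite hD (finite_range a)
    obtain ⟨G, hGD, hGS, hcard, z, hz, -, hg⟩ := hD.exists_interalgebraic hf hf₁ hf₂ hint
      (Nat.card β) hpq ((finite_range a).union hFfin)
    refine ⟨z, hsub hz, fun h hh hzψ => ?_⟩
    obtain ⟨g, hgG, hgh⟩ : ∃ g ∈ G, g ∉ range h := by
      by_contra! hcon
      have h1 := encard_le_encard (show G ⊆ range h from hcon)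
      have h2 : (range h).encard ≤ Nat.card β := by
        rw [← image_univ]
        refine (encard_image_le _ _).trans ?_
        rw [encard_univ, ENat.card_eq_coe_natCard]
      rw [hcard] at h1
      have := h1.trans h2
      exact absurd this (by exact_mod_cast Nat.not_succ_le_self _)
    have hzacl : z ∈ acl L (range a ∪ F ∪ D \ {g}) := by
      refine ⟨ι ⊕ β, inferInstance, Sum.elim a h, ψ, ?_, finite_iff_exists_lt.2 ⟨k, hψ h⟩, hzψ⟩
      rintro (i | i)
      · exact Or.inl (Or.inl (mem_range_self i))
      · exact Or.inr ⟨hh i, fun e => hgh ⟨i, e⟩⟩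
    refine hF g (hGD hgG) (disjoint_left.1 hGS hgG) (acl_subset_of_subset_acl ?_ (hg g hgG))
    rintro y (rfl | hy)
    · exact hzacl
    · exact subset_acl _ (Or.inr ⟨hGD hy.1, hy.2⟩)

end Extension

/-! ### Ultrapowers of `H`-structures -/

section Ultrapower

/-- The ultrapower of `M`. -/
abbrev Ultrapower {I : Type w} (U : Ultrafilter I) (M : Type w') : Type (max w w') :=
  (U : Filter I).Product fun _ => M

namespace Ultrapower

variable {I : Type w} {U : Ultrafilter I} {M : Type w'}

/-- The class of a function in the ultrapower. -/
def mk (U : Ultrafilter I) (g : I → M) : Ultrapower U M := (g : (U : Filter I).Product fun _ => M)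

theorem mk_eq_mk {g g' : I → M} : mk U g = mk U g' ↔ ∀ᶠ t in U, g t = g' t := Quotient.eq''

theorem exists_rep (x : Ultrapower U M) : ∃ g, mk U g = x := Quotient.exists_rep x

theorem exists_rep_tuple {ι : Type*} (x : ι → Ultrapower U M) :
    ∃ g : ι → I → M, x = fun i => mk U (g i) := by
  choose g hg using fun i => exists_rep (x i)
  exact ⟨g, funext fun i => (hg i).symm⟩

/-- The ultrapower of a unary predicate. -/
def pred (U : Ultrafilter I) (D : Set M) : Set (Ultrapower U M) :=
  {x | ∃ g, mk U g = x ∧ ∀ᶠ t in U, g t ∈ D}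

theorem mk_mem_pred {D : Set M} {g : I → M} : mk U g ∈ pred U D ↔ ∀ᶠ t in U, g t ∈ D := by
  constructor
  · rintro ⟨g', hg', h⟩
    filter_upwards [mk_eq_mk.1 hg', h] with t ht h
    rwa [← ht]
  · exact fun h => ⟨g, rfl, h⟩

variable [Nonempty M] {L : FirstOrder.Language.{u, v}} [L.Structure M]

theorem realize_mk {α : Type*} (φ : L.Formula α) (x : α → I → M) :
    φ.Realize (fun i => mk U (x i)) ↔ ∀ᶠ t in U, φ.Realize fun i => x i t :=
  Ultraproduct.realize_formula_cast φ x

theorem mk_mem_solutions {α : Type} {φ : L.Formula (α ⊕ Unit)} {x : α → I → M} {y : I → M} :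
    mk U y ∈ solutions φ (fun i => mk U (x i)) ↔
      ∀ᶠ t in U, y t ∈ solutions φ fun i => x i t := by
  have h1 : (Sum.elim (fun i => mk U (x i)) fun _ : Unit => mk U y) =
      fun i => mk U (Sum.elim x (fun _ => y) i) := by
    funext i; rcases i with i | i <;> rfl
  have h2 : ∀ t, (Sum.elim (fun i => x i t) fun _ : Unit => y t) =
      fun i => Sum.elim x (fun _ => y) i t := by
    intro t; funext i; rcases i with i | i <;> rfl
  simp only [mem_solutions]
  rw [h1, realize_mk]
  simp only [h2]

theorem le_encard_solutions {α : Type} {φ : L.Formula (α ⊕ Unit)} {x : α → I → M} {k : ℕ} :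
    (k : ℕ∞) ≤ (solutions φ fun i => mk U (x i)).encard ↔
      ∀ᶠ t in U, (k : ℕ∞) ≤ (solutions φ fun i => x i t).encard := by
  simp only [← realize_atLeast]
  exact realize_mk _ _

theorem encard_solutions_lt {α : Type} {φ : L.Formula (α ⊕ Unit)} {x : α → I → M} {k : ℕ} :
    (solutions φ fun i => mk U (x i)).encard < k ↔
      ∀ᶠ t in U, (solutions φ fun i => x i t).encard < k := by
  rw [← not_le, le_encard_solutions, ← Ultrafilter.eventually_not]
  simp only [not_le]

instance [(langH L).Structure M] (D : Set M) [hD : IsPredExpansion L D] :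
    IsPredExpansion L (M := Ultrapower U M) (pred U D) where
  isExpansionOn := by
    have := hD.isExpansionOn
    constructor
    · intro n f x
      obtain ⟨g, rfl⟩ := exists_rep_tuple x
      refine (Ultraproduct.funMap_cast (L := langH L) _ g).trans
        (Eq.trans ?_ (Ultraproduct.funMap_cast f g).symm)
      simp only [LHom.map_onFunction]
    · intro n R x
      obtain ⟨g, rfl⟩ := exists_rep_tuple x
      have h1 := realize_mk (U := U) (R.formula Term.var) g
      have h2 := realize_mk (U := U) (((LHom.sumInl : L →ᴸ langH L).onRelation R).formula Term.var) g
      simp only [Formula.realize_rel, Term.realize_var, LHom.map_onRelation] at h1 h2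
      exact propext (h2.trans h1.symm)
  relMap_symH := by
    intro x
    obtain ⟨g, rfl⟩ := exists_rep_tuple x
    have h2 := realize_mk (U := U) ((symH : (langH L).Relations 1).formula Term.var) g
    simp only [Formula.realize_rel, Term.realize_var, hD.relMap_symH] at h2
    rw [h2, mk_mem_pred]

/-- The diagonal embedding. -/
def diag (U : Ultrafilter I) (a : M) : Ultrapower U M := mk U fun _ => a

variable {D : Set M}

/-- A dependence involves one formula, one bound `k` and finitely many elements, so by Łoś it
already occurs at some index. -/
theorem indepOver {ι : Type} [Finite ι] {a : ι → M} (h : IndepOver L D (range a)) :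
    IndepOver L (pred U D) (range fun i => diag U (a i)) := by
  intro x hx hxa hxacl
  obtain ⟨β, _, b, ψ, hb, hfin, hxψ⟩ := mem_acl_range_union hxacl
  obtain ⟨k, hk⟩ := finite_iff_exists_lt.1 hfin
  obtain ⟨x, rfl⟩ := exists_rep x
  obtain ⟨b, rfl⟩ := exists_rep_tuple b
  have e : (Sum.elim (fun i => diag U (a i)) fun i => mk U (b i)) =
      fun i => mk U (Sum.elim (fun i _ => a i) b i) := by
    funext i; rcases i with i | i <;> rfl
  rw [e] at hk hxψ
  rw [encard_solutions_lt] at hk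
  rw [mk_mem_solutions] at hxψ
  rw [mk_mem_pred] at hx
  have hb1 : ∀ᶠ t in U, ∀ i, b i t ∈ D := Filter.eventually_all.2 fun i => mk_mem_pred.1 (hb i).1
  have hb2 : ∀ᶠ t in U, ∀ i, b i t ≠ x t := Filter.eventually_all.2 fun i =>
    Ultrafilter.eventually_not.2 fun h => (hb i).2 (mk_eq_mk.2 h)
  have hxa' : ∀ᶠ t in U, ∀ i, a i ≠ x t := Filter.eventually_all.2 fun i =>
    Ultrafilter.eventually_not.2 fun h => hxa ⟨i, mk_eq_mk.2 h⟩
  obtain ⟨t, h1, h2, h3, h4, h5, h6⟩ :=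
    (hk.and (hxψ.and (hx.and (hb1.and (hb2.and hxa'))))).exists
  refine h (x t) h3 (by rintro ⟨i, hi⟩; exact h6 i hi)
    ⟨ι ⊕ β, inferInstance, _, ψ, ?_, finite_iff_exists_lt.2 ⟨k, h1⟩, h2⟩
  rintro (i | i)
  · exact Or.inl (mem_range_self i)
  · exact Or.inr ⟨h4 i, h5 i⟩

/-- Uniform finiteness is needed because an infinite set in the ultrapower may come from sets that
are merely large and finite; beyond the bound `k` these are infinite. -/
theorem isDense (hfin : UniformFinite L M) (hD : IsDense L D) : IsDense L (pred U D) := by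
  intro ι _ φ a hφ
  obtain ⟨a, rfl⟩ := exists_rep_tuple a
  obtain ⟨k, hk⟩ := hfin ι φ
  have h1 := le_encard_solutions.1 (realize_atLeast.1 (infinite_iff_forall_atLeast.1 hφ k))
  have h2 : ∀ᶠ t in U, ∃ x, x ∈ D ∧ x ∈ solutions φ fun i => a i t :=
    h1.mono fun t ht => hD ι φ _ (hk _ ht)
  obtain ⟨x, hx⟩ := h2.choice
  exact ⟨mk U x, mk_mem_pred.2 (hx.mono fun t h => h.1), mk_mem_solutions.2 (hx.mono fun t h => h.2)⟩

theorem uniformFinite (hfin : UniformFinite L M) : UniformFinite L (Ultrapower U M) := by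
  intro ι _ φ
  obtain ⟨k, hk⟩ := hfin ι φ
  refine ⟨k, fun a ha => infinite_iff_forall_atLeast.2 fun m => realize_atLeast.2 ?_⟩
  obtain ⟨a, rfl⟩ := exists_rep_tuple a
  rw [le_encard_solutions] at ha ⊢
  exact ha.mono fun t ht => realize_atLeast.1 (infinite_iff_forall_atLeast.1 (hk _ ht) m)

theorem isHStructure (h : IsHStructure L D) : IsHStructure L (pred U D) where
  uniformFinite := uniformFinite h.uniformFinite
  indep := by
    have := indepOver (U := U) (L := L) (D := D) (a := Empty.elim) (by
      rw [range_eq_empty]; exact h.indep)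
    rwa [range_eq_empty] at this
  dense := isDense h.uniformFinite h.dense
  extension := by
    intro ι β _ _ k φ ψ a hψ hφ
    obtain ⟨a, rfl⟩ := exists_rep_tuple a
    obtain ⟨N, hN⟩ := h.uniformFinite ι φ
    have h1 : ∀ᶠ t in U, (solutions φ fun i => a i t).Infinite :=
      (le_encard_solutions.1 (realize_atLeast.1 (infinite_iff_forall_atLeast.1 hφ N))).mono
        fun t ht => hN _ ht
    have e : ∀ y : β → I → M, (Sum.elim (fun i => mk U (a i)) fun i => mk U (y i)) =
        fun i => mk U (Sum.elim a y i) := by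
      intro y; funext i; rcases i with i | i <;> rfl
    have e' : ∀ (y : β → I → M) t, (fun i => Sum.elim a y i t) =
        Sum.elim (fun i => a i t) fun i => y i t := by
      intro y t; funext i; rcases i with i | i <;> rfl
    -- Otherwise bad tuples chosen at almost every index would form a bad tuple of the ultrapower.
    have h2 : ∀ᶠ t in U, ∀ y : β → M,
        (solutions ψ (Sum.elim (fun i => a i t) y)).encard < k := by
      by_contra hcon
      rw [← Ultrafilter.eventually_not] at hcon
      simp only [not_forall] at hcon
      obtain ⟨y, hy⟩ := hcon.choice
      have := hψ fun i => mk U fun t => y t i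
      rw [e, encard_solutions_lt] at this
      obtain ⟨t, ht, ht'⟩ := (hy.and this).exists
      rw [e'] at ht'
      exact ht ht'
    have h3 : ∀ᶠ t in U, ∃ x, (x ∈ solutions φ fun i => a i t) ∧
        ∀ h : β → M, (∀ i, h i ∈ D) → x ∉ solutions ψ (Sum.elim (fun i => a i t) h) := by
      filter_upwards [h1, h2] with t ht ht'
      exact h.extension ι β k φ ψ _ ht' ht
    obtain ⟨x, hx⟩ := h3.choice
    refine ⟨mk U x, mk_mem_solutions.2 (hx.mono fun t h => h.1), fun g hg hxg => ?_⟩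
    obtain ⟨g, rfl⟩ := exists_rep_tuple g
    have hg' : ∀ᶠ t in U, ∀ i, g i t ∈ D := Filter.eventually_all.2 fun i => mk_mem_pred.1 (hg i)
    rw [e, mk_mem_solutions] at hxg
    obtain ⟨t, h4, h5, h6⟩ := (hx.and (hg'.and hxg)).exists
    rw [e'] at h6
    exact h4.2 _ h5 h6

end Ultrapower

end Ultrapower

/-! ### Extending partial equivalences of tuples -/

section GoodPair

variable {L : FirstOrder.Language.{u, v}} {M : Type w} [L.Structure M] {N : Type w} [L.Structure N]
  {ι : Type}

theorem exists_formula_of_mem_acl_range {a : ι → M} {x : M} (hx : x ∈ acl L (range a)) :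
    ∃ ψ : L.Formula (ι ⊕ Unit), (solutions ψ a).Finite ∧ x ∈ solutions ψ a := by
  rw [← union_empty (range a)] at hx
  obtain ⟨β, _, b, ψ, hb, hψ⟩ := mem_acl_range_union hx
  refine ⟨ψ.relabel (Sum.map (Sum.elim id fun i => (hb i).elim) id), ?_⟩
  rw [solutions_relabel]
  have : a ∘ (Sum.elim id fun i => (hb i).elim) = Sum.elim a b := by
    funext i
    rcases i with i | i
    · rfl
    · exact (hb i).elim
  rwa [this]

theorem IndepOver.mem_of_mem_acl {D A : Set M} (h : IndepOver L D A) {x : M} (hx : x ∈ D)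
    (hxA : x ∈ acl L A) : x ∈ A := by
  by_contra hcon
  exact h x hx hcon (acl_mono subset_union_left hxA)

theorem range_elim_const (a : ι → M) (c : M) :
    range (Sum.elim a fun _ : Unit => c) = insert c (range a) := by
  rw [Sum.elim_range, range_const, union_singleton]

/-- The tuples `a` and `b` have the same type in the language `L` and in the predicate, and the
predicates are independent over them. -/
structure GoodPair (L : FirstOrder.Language.{u, v}) {M : Type w} [L.Structure M] {N : Type w}
    [L.Structure N] {ι : Type} (D : Set M) (E : Set N) (a : ι → M) (b : ι → N) : Prop where
  left : IndepOver L D (range a)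
  right : IndepOver L E (range b)
  mem_iff : ∀ i, a i ∈ D ↔ b i ∈ E
  realize_iff : ∀ φ : L.Formula ι, φ.Realize a ↔ φ.Realize b

variable {D : Set M} {E : Set N} {a : ι → M} {b : ι → N}

theorem GoodPair.symm (h : GoodPair L D E a b) : GoodPair L E D b a :=
  ⟨h.right, h.left, fun i => (h.mem_iff i).symm, fun φ => (h.realize_iff φ).symm⟩

/-- By independence, an element of `D` algebraic over `a` is some `a i`; the `L`-type then forces `d
= b i`. -/
theorem mem_of_mem_acl_of_realize_iff {c : M} {d : N} (hD : IndepOver L D (range a))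
    (hab : ∀ i, a i ∈ D ↔ b i ∈ E)
    (hcd : ∀ φ : L.Formula (ι ⊕ Unit), c ∈ solutions φ a ↔ d ∈ solutions φ b)
    (hc : c ∈ acl L (range a)) (hcD : c ∈ D) : d ∈ E := by
  obtain ⟨i, rfl⟩ := hD.mem_of_mem_acl hcD hc
  have := (hcd ((Term.var (Sum.inl i)).equal (Term.var (Sum.inr ())))).1 (by simp [mem_solutions])
  have : b i = d := by simpa [mem_solutions] using this
  rw [← this]
  exact (hab i).1 hcD

theorem GoodPair.encard_lt_iff (h : GoodPair L D E a b) {φ : L.Formula (ι ⊕ Unit)} {k : ℕ} :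
    (solutions φ a).encard < k ↔ (solutions φ b).encard < k := by
  rw [← not_le, ← not_le, ← realize_atLeast, ← realize_atLeast, h.realize_iff]

theorem GoodPair.infinite_iff (h : GoodPair L D E a b) {φ : L.Formula (ι ⊕ Unit)} :
    (solutions φ a).Infinite ↔ (solutions φ b).Infinite := by
  simp only [infinite_iff_forall_atLeast, h.realize_iff]

theorem GoodPair.nonempty (h : GoodPair L D E a b) {φ : L.Formula (ι ⊕ Unit)}
    (hφ : (solutions φ b).Nonempty) : (solutions φ a).Nonempty := by
  rw [← one_le_encard_iff_nonempty] at hφ ⊢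
  have := realize_atLeast (k := 1) (φ := φ) (a := b)
  rw [← h.realize_iff, realize_atLeast] at this
  exact_mod_cast this.2 (by exact_mod_cast hφ)

theorem infinite_of_notMem_acl {A : Set M} {c : M} (hc : c ∉ acl L A) [Finite ι]
    (ha : ∀ i, a i ∈ A) {φ : L.Formula (ι ⊕ Unit)} (hφ : c ∈ solutions φ a) :
    (solutions φ a).Infinite := fun h => hc ⟨ι, inferInstance, a, φ, ha, h, hφ⟩

/-- If all formulas true of `d` over `b` are compatible over `a` with the filter `F`, then the type
of `d` over `b` is realized over `a` in an ultrapower by an ultrafilter finer than `F`. -/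
theorem exists_ultrafilter_realize_iff [Nonempty M] (d : N) (F : Filter M)
    (hF : ∀ φ : L.Formula (ι ⊕ Unit), d ∈ solutions φ b → ∀ Y ∈ F, (solutions φ a ∩ Y).Nonempty) :
    ∃ U : Ultrafilter M, (U : Filter M) ≤ F ∧ ∀ φ : L.Formula (ι ⊕ Unit),
      Ultrapower.mk U id ∈ solutions φ (fun i => Ultrapower.diag U (a i)) ↔ d ∈ solutions φ b := by
  -- The filter generated by the solution sets over `a` of the formulas in the type of `d` over `b`.
  let G : Filter M :=
    { sets := {s | ∃ φ : L.Formula (ι ⊕ Unit), d ∈ solutions φ b ∧ solutions φ a ⊆ s}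
      univ_sets := ⟨⊤, by simp [mem_solutions], subset_univ _⟩
      sets_of_superset := fun ⟨φ, h, h'⟩ hst => ⟨φ, h, h'.trans hst⟩
      inter_sets := fun ⟨φ, h1, h1'⟩ ⟨ψ, h2, h2'⟩ => ⟨φ ⊓ ψ, by
        rw [solutions_inf]; exact ⟨h1, h2⟩, by
        rw [solutions_inf]; exact inter_subset_inter h1' h2'⟩ }
  have : (F ⊓ G).NeBot := by
    rw [Filter.inf_neBot_iff]
    rintro Y hY s ⟨φ, hφ, hs⟩
    obtain ⟨x, hx, hxY⟩ := hF φ hφ Y hY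
    exact ⟨x, hxY, hs hx⟩
  let U := Ultrafilter.of (F ⊓ G)
  have hU : (U : Filter M) ≤ F ⊓ G := Ultrafilter.of_le _
  have key : ∀ φ : L.Formula (ι ⊕ Unit), d ∈ solutions φ b →
      Ultrapower.mk U id ∈ solutions φ (fun i => Ultrapower.diag U (a i)) := fun φ hφ =>
    Ultrapower.mk_mem_solutions.2 (hU.trans inf_le_right ⟨φ, hφ, fun x hx => hx⟩)
  refine ⟨U, hU.trans inf_le_left, fun φ => ⟨fun h => ?_, key φ⟩⟩
  by_contra hcon
  have := key (∼φ) (by simpa [mem_solutions] using hcon)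
  simp only [mem_solutions, Formula.realize_not] at this
  exact this h

/-- Subsets of the union of a uniformly finite family of sets parametrized by `D`. -/
def IsSmallOver (L : FirstOrder.Language.{u, v}) {M : Type w} [L.Structure M] {ι : Type}
    (D : Set M) (a : ι → M) (X : Set M) : Prop :=
  ∃ (β : Type) (_ : Finite β) (k : ℕ) (ψ : L.Formula ((ι ⊕ β) ⊕ Unit)),
    (∀ y : β → M, (solutions ψ (Sum.elim a y)).encard < k) ∧
      ∀ x ∈ X, ∃ h : β → M, (∀ i, h i ∈ D) ∧ x ∈ solutions ψ (Sum.elim a h)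

theorem isSmallOver_empty : IsSmallOver L D a ∅ :=
  ⟨Empty, inferInstance, 1, ⊥, fun y => by
    have : solutions (⊥ : L.Formula ((ι ⊕ Empty) ⊕ Unit)) (Sum.elim a y) = ∅ := by
      ext; simp [mem_solutions]
    simp [this], by simp⟩

/-- The parameter tuples are concatenated; an element of `D` is needed to fill the unused half. -/
theorem IsSmallOver.union {X Y : Set M} (hX : IsSmallOver L D a X) (hY : IsSmallOver L D a Y)
    (hD : D.Nonempty) : IsSmallOver L D a (X ∪ Y) := by
  obtain ⟨x₀, hx₀⟩ := hD
  obtain ⟨β, _, k, φ, hφ, hX⟩ := hX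
  obtain ⟨γ, _, m, ψ, hψ, hY⟩ := hY
  let χ : L.Formula ((ι ⊕ (β ⊕ γ)) ⊕ Unit) := φ.relabel (Sum.map (Sum.map id Sum.inl) id) ⊔
    ψ.relabel (Sum.map (Sum.map id Sum.inr) id)
  have key : ∀ (y : β → M) (z : γ → M), solutions χ (Sum.elim a (Sum.elim y z)) =
      solutions φ (Sum.elim a y) ∪ solutions ψ (Sum.elim a z) := by
    intro y z
    ext x
    rw [mem_union, mem_solutions, Formula.realize_sup, ← mem_solutions, ← mem_solutions,
      solutions_relabel, solutions_relabel, Sum.elim_comp_map, Sum.elim_comp_map,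
      Sum.elim_comp_inl, Sum.elim_comp_inr]
    rfl
  refine ⟨β ⊕ γ, inferInstance, k + m, χ, fun y => ?_, ?_⟩
  · rw [← Sum.elim_comp_inl_inr y, key]
    refine (encard_union_le _ _).trans_lt ?_
    rw [Nat.cast_add]
    exact ENat.add_lt_add (hφ _) (hψ _)
  · rintro x (hx | hx)
    · obtain ⟨h, hh, hxh⟩ := hX x hx
      exact ⟨Sum.elim h fun _ => x₀, by rintro (i | i); exacts [hh i, hx₀],
        by rw [key]; exact Or.inl hxh⟩
    · obtain ⟨h, hh, hxh⟩ := hY x hx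
      exact ⟨Sum.elim (fun _ => x₀) h, by rintro (i | i); exacts [hx₀, hh i],
        by rw [key]; exact Or.inr hxh⟩

theorem isSmallOver_of_formula {β : Type} [Finite β] (k : ℕ) (ψ : L.Formula ((ι ⊕ β) ⊕ Unit)) :
    IsSmallOver L D a {x | ∃ h : β → M, (∀ i, h i ∈ D) ∧ x ∈ solutions ψ (Sum.elim a h) ∧
      (solutions ψ (Sum.elim a h)).encard < k} := by
  let χ : L.Formula ((ι ⊕ β) ⊕ Unit) := ψ ⊓ Formula.relabel Sum.inl (∼(atLeast k ψ))
  have key : ∀ y : β → M, solutions χ (Sum.elim a y) =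
      {x | x ∈ solutions ψ (Sum.elim a y) ∧ (solutions ψ (Sum.elim a y)).encard < k} := by
    intro y
    ext x
    rw [solutions_inf, mem_inter_iff, mem_ofPred_eq, mem_solutions (φ := Formula.relabel _ _),
      Formula.realize_relabel, Sum.elim_comp_inl, Formula.realize_not, realize_atLeast, not_le]
  -- The bound `k + 1` rather than `k` covers `k = 0`, where the empty set does not have fewer than
  -- `k` elements.
  refine ⟨β, inferInstance, k + 1, χ, fun y => ?_, ?_⟩
  · rw [key]
    by_cases h : (solutions ψ (Sum.elim a y)).encard < k
    · exact (encard_le_encard fun x hx => hx.1).trans_lt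
        (h.trans (by exact_mod_cast Nat.lt_succ_self k))
    · simp [h]
  · rintro x ⟨h, hh, hx⟩
    exact ⟨h, hh, by rw [key]; exact hx⟩

variable [Finite ι]

/-- A good pair of tuples can be extended by an algebraic element, by an element of the predicate,
or by an element that is not algebraic over the predicate, in an ultrapower of `M`. -/
theorem GoodPair.exists_extend [Nonempty M] (hM : IsHStructure L D) (hN : IsHStructure L E)
    (h : GoodPair L D E a b) (d : N)
    (hd : d ∈ acl L (range b) ∨ d ∈ E ∨ d ∉ acl L (range b ∪ E)) :
    ∃ U : Ultrafilter M, GoodPair L (Ultrapower.pred U D) E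
      (Sum.elim (fun i => Ultrapower.diag U (a i)) fun _ : Unit => Ultrapower.mk U id)
      (Sum.elim b fun _ : Unit => d) := by
  have build : ∀ (U : Ultrafilter M), (∀ φ : L.Formula (ι ⊕ Unit),
      Ultrapower.mk U id ∈ solutions φ (fun i => Ultrapower.diag U (a i)) ↔ d ∈ solutions φ b) →
      IndepOver L (Ultrapower.pred U D)
        (insert (Ultrapower.mk U id) (range fun i => Ultrapower.diag U (a i))) →
      IndepOver L E (insert d (range b)) →
      (Ultrapower.mk U id ∈ Ultrapower.pred U D ↔ d ∈ E) →
      GoodPair L (Ultrapower.pred U D) E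
        (Sum.elim (fun i => Ultrapower.diag U (a i)) fun _ : Unit => Ultrapower.mk U id)
        (Sum.elim b fun _ : Unit => d) := by
    intro U hU h1 h2 h3
    refine ⟨by rwa [range_elim_const], by rwa [range_elim_const], ?_, hU⟩
    rintro (i | i)
    · refine Iff.trans ?_ (h.mem_iff i)
      simp only [Sum.elim_inl, Ultrapower.diag, Ultrapower.mk_mem_pred, Filter.eventually_const]
    · exact h3
  by_cases hacl : d ∈ acl L (range b)
  · obtain ⟨U, -, hU⟩ := exists_ultrafilter_realize_iff (a := a) (b := b) (L := L) d ⊤ (by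
      intro φ hφ Y hY
      rw [Filter.mem_top.1 hY, inter_univ]
      exact h.nonempty ⟨d, hφ⟩)
    have hdiag : ∀ i, Ultrapower.diag U (a i) ∈ Ultrapower.pred U D ↔ b i ∈ E := fun i => by
      rw [← h.mem_iff i]
      simp only [Ultrapower.diag, Ultrapower.mk_mem_pred, Filter.eventually_const]
    have hind := Ultrapower.indepOver (U := U) h.left
    have hcacl : Ultrapower.mk U id ∈ acl L (range fun i => Ultrapower.diag U (a i)) := by
      obtain ⟨ψ, hfin, hψ⟩ := exists_formula_of_mem_acl_range hacl
      obtain ⟨k, hk⟩ := finite_iff_exists_lt.1 hfin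
      refine ⟨ι, inferInstance, _, ψ, mem_range_self, finite_iff_exists_lt.2 ⟨k, ?_⟩, (hU ψ).2 hψ⟩
      refine Ultrapower.encard_solutions_lt.2 ?_
      simp only [Filter.eventually_const]
      exact h.encard_lt_iff.2 hk
    exact ⟨U, build U hU (hind.insert_of_mem_acl hcacl) (h.right.insert_of_mem_acl hacl)
      ⟨mem_of_mem_acl_of_realize_iff hind hdiag hU hcacl,
        mem_of_mem_acl_of_realize_iff h.right (fun i => (hdiag i).symm) (fun φ => (hU φ).symm)
          hacl⟩⟩
  have hinf : ∀ φ : L.Formula (ι ⊕ Unit), d ∈ solutions φ b → (solutions φ a).Infinite :=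
    fun φ hφ => h.infinite_iff.2 (infinite_of_notMem_acl hacl mem_range_self hφ)
  by_cases hdE : d ∈ E
  -- Density says exactly that the type of `d` is compatible with the set `D`.
  · obtain ⟨U, hUD, hU⟩ := exists_ultrafilter_realize_iff (a := a) (b := b) (L := L) d
      (Filter.principal D) (by
        intro φ hφ Y hY
        obtain ⟨x, hx, hxφ⟩ := hM.dense ι φ a (hinf φ hφ)
        exact ⟨x, hxφ, hY hx⟩)
    have hc : Ultrapower.mk U id ∈ Ultrapower.pred U D :=
      Ultrapower.mk_mem_pred.2 (hUD (Filter.mem_principal_self D))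
    refine ⟨U, build U hU ?_ ?_ ⟨fun _ => hdE, fun _ => hc⟩⟩
    · rw [← union_singleton]
      exact (Ultrapower.indepOver h.left).union (singleton_subset_iff.2 hc)
    · rw [← union_singleton]
      exact h.right.union (singleton_subset_iff.2 hdE)
  have hdn : d ∉ acl L (range b ∪ E) := by tauto
  have hDne : D.Nonempty := by
    obtain ⟨x, hx, -⟩ := hM.dense ι ⊤ a (hinf ⊤ (by simp [mem_solutions]))
    exact ⟨x, hx⟩
  -- The sets with small complement. The extension axiom says that infinite solution sets meet all
  -- of them, so the new element can avoid everything algebraic over `a` and the predicate.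
  let F : Filter M :=
    { sets := {s | IsSmallOver L D a sᶜ}
      univ_sets := by
        rw [mem_ofPred_eq, compl_univ]
        exact isSmallOver_empty
      sets_of_superset := fun ⟨β, hβ, k, ψ, h1, h2⟩ hst =>
        ⟨β, hβ, k, ψ, h1, fun x hx => h2 x (compl_subset_compl.2 hst hx)⟩
      inter_sets := fun hX hY => by
        rw [mem_ofPred_eq, compl_inter]
        exact IsSmallOver.union hX hY hDne }
  obtain ⟨U, hUF, hU⟩ := exists_ultrafilter_realize_iff (a := a) (b := b) (L := L) d F (by
    rintro φ hφ Y ⟨β, _, k, ψ, h1, h2⟩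
    obtain ⟨x, hx, hxψ⟩ := hM.extension ι β k φ ψ a h1 (hinf φ hφ)
    refine ⟨x, hx, ?_⟩
    by_contra hxY
    obtain ⟨g, hg, hxg⟩ := h2 x hxY
    exact hxψ g hg hxg)
  have hc : Ultrapower.mk U id ∉
      acl L ((range fun i => Ultrapower.diag U (a i)) ∪ Ultrapower.pred U D) := by
    intro hc
    obtain ⟨β, _, g, ψ, hg, hfin, hψ⟩ := mem_acl_range_union hc
    obtain ⟨k, hk⟩ := finite_iff_exists_lt.1 hfin
    obtain ⟨g, rfl⟩ := Ultrapower.exists_rep_tuple g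
    have e : (Sum.elim (fun i => Ultrapower.diag U (a i)) fun i => Ultrapower.mk U (g i)) =
        fun i => Ultrapower.mk U (Sum.elim (fun i _ => a i) g i) := by
      funext i; rcases i with i | i <;> rfl
    have e' : ∀ t, (fun i => Sum.elim (fun i _ => a i) g i t) =
        Sum.elim a fun i => g i t := by
      intro t; funext i; rcases i with i | i <;> rfl
    rw [e] at hk hψ
    rw [Ultrapower.encard_solutions_lt] at hk
    rw [Ultrapower.mk_mem_solutions] at hψ
    simp only [e'] at hk hψ
    have hg' : ∀ᶠ t in U, ∀ i, g i t ∈ D :=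
      Filter.eventually_all.2 fun i => Ultrapower.mk_mem_pred.1 (hg i)
    have hsmall : ∀ᶠ t in U, t ∈ {x | ∃ h : β → M, (∀ i, h i ∈ D) ∧
        x ∈ solutions ψ (Sum.elim a h) ∧ (solutions ψ (Sum.elim a h)).encard < k}ᶜ :=
      hUF ((congrArg (IsSmallOver L D a) (compl_compl _)).mpr (isSmallOver_of_formula k ψ))
    obtain ⟨t, h1, h2, h3, h4⟩ := (hk.and (hψ.and (hg'.and hsmall))).exists
    exact h4 ⟨fun i => g i t, h3, h2, h1⟩
  refine ⟨U, build U hU ?_ ?_ ⟨fun hcD => ?_, fun h => (hdE h).elim⟩⟩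
  · exact (Ultrapower.indepOver h.left).insert_of_notMem_acl
      (Ultrapower.isDense hM.uniformFinite hM.dense) hc
  · exact h.right.insert_of_notMem_acl hN.dense hdn
  · exact (hc (subset_acl _ (Or.inr hcD))).elim

end GoodPair

/-! ### Elementary equivalence of `H`-structures -/

section Equivalence

variable {L : FirstOrder.Language.{u, v}}

/-- The truth of `θ` does not distinguish good pairs of tuples in `H`-structures. -/
def IsInvariant {n : ℕ} (θ : (langH L).BoundedFormula Empty n) : Prop :=
  ∀ (ι : Type) [Finite ι] (M N : Type w) [L.Structure M] [L.Structure N]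
    [(langH L).Structure M] [(langH L).Structure N] [Nonempty M] [Nonempty N] (D : Set M) (E : Set N)
    [IsPredExpansion L D] [IsPredExpansion L E] (a : ι → M) (b : ι → N) (t : Fin n → ι),
    IsHStructure L D → IsHStructure L E → GoodPair L D E a b →
      (θ.Realize (Empty.elim : Empty → M) (a ∘ t) → θ.Realize (Empty.elim : Empty → N) (b ∘ t))

theorem exists_onTerm_eq {α : Type*} (τ : (langH L).Term α) :
    ∃ σ : L.Term α, (LHom.sumInl : L →ᴸ langH L).onTerm σ = τ := by
  induction τ with
  | var i => exact ⟨Term.var i, rfl⟩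
  | func f ts ih =>
    choose σ hσ using ih
    rcases f with f | f
    · exact ⟨Term.func f σ, by simp only [LHom.onTerm, hσ]; rfl⟩
    · exact Empty.elim f

variable {M N : Type w} [L.Structure M] [L.Structure N] {D : Set M} {E : Set N} {ι : Type}
    {a : ι → M} {b : ι → N}

/-- The predicate may be applied to a term, not just a variable; by independence a term value in `D`
is already an entry of `a`. -/
theorem GoodPair.realize_mem_of_realize_mem [Finite ι] (h : GoodPair L D E a b) (σ : L.Term ι)
    (hσ : σ.realize a ∈ D) : σ.realize b ∈ E := by
  have hsol : solutions ((Term.var (Sum.inr ())).equal (σ.relabel Sum.inl)) a = {σ.realize a} := by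
    ext x
    simp [mem_solutions, Sum.elim_comp_inl]
  obtain ⟨i, hi⟩ := h.left.mem_of_mem_acl hσ ⟨ι, inferInstance, a, _, mem_range_self,
    by rw [hsol]; exact finite_singleton _, by rw [hsol]; rfl⟩
  have := h.realize_iff (σ.equal (Term.var i))
  simp only [Formula.realize_equal, Term.realize_var] at this
  rw [this.1 hi.symm, ← h.mem_iff, hi]
  exact hσ

theorem realize_elim_comp {n : ℕ} (σ : L.Term (Empty ⊕ Fin n)) (a : ι → M) (t : Fin n → ι) :
    σ.realize (Sum.elim Empty.elim (a ∘ t)) =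
      (σ.relabel (Sum.elim Empty.elim t)).realize a := by
  rw [Term.realize_relabel]
  congr 1
  funext i
  rcases i with i | i
  · exact i.elim
  · rfl

theorem isInvariant_equal {n : ℕ} (τ₁ τ₂ : (langH L).Term (Empty ⊕ Fin n)) :
    IsInvariant.{u, v, w} (BoundedFormula.equal τ₁ τ₂) := by
  intro ι _ M N _ _ _ _ _ _ D E hD hE a b t hM hN h
  have := hD.isExpansionOn
  have := hE.isExpansionOn
  obtain ⟨σ₁, rfl⟩ := exists_onTerm_eq τ₁
  obtain ⟨σ₂, rfl⟩ := exists_onTerm_eq τ₂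
  simp only [BoundedFormula.Realize, LHom.realize_onTerm, realize_elim_comp]
  have := h.realize_iff ((σ₁.relabel (Sum.elim Empty.elim t)).equal
    (σ₂.relabel (Sum.elim Empty.elim t)))
  simp only [Formula.realize_equal] at this
  exact this.1

theorem isInvariant_rel {n l : ℕ} (R : (langH L).Relations l)
    (τ : Fin l → (langH L).Term (Empty ⊕ Fin n)) :
    IsInvariant.{u, v, w} (BoundedFormula.rel R τ) := by
  intro ι _ M N _ _ _ _ _ _ D E hD hE a b t hM hN h
  have := hD.isExpansionOn
  have := hE.isExpansionOn
  choose σ hσ using fun i => exists_onTerm_eq (τ i)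
  obtain rfl : τ = fun i => (LHom.sumInl : L →ᴸ langH L).onTerm (σ i) := (funext hσ).symm
  simp only [BoundedFormula.Realize, LHom.realize_onTerm, realize_elim_comp]
  rcases R with R | R
  · have := h.realize_iff (R.formula fun i => (σ i).relabel (Sum.elim Empty.elim t))
    simp only [Formula.realize_rel] at this
    rw [← LHom.map_onRelation (LHom.sumInl : L →ᴸ langH L),
      ← LHom.map_onRelation (LHom.sumInl : L →ᴸ langH L)] at this
    exact this.1
  · cases R
    intro hR
    exact (hE.relMap_symH _).2 (h.realize_mem_of_realize_mem _ ((hD.relMap_symH _).1 hR))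

/-- Łoś brings the counterexample found in an ultrapower back to `M`. -/
theorem exists_not_realize_of_ultrapower {M : Type w} [(langH L).Structure M] [Nonempty M] {a : ι → M} {n : ℕ}
    {θ : (langH L).BoundedFormula Empty (n + 1)} {U : Ultrafilter M} {t : Fin n → ι}
    (h : ∃ c, ¬θ.Realize Empty.elim
      (Fin.snoc ((fun i => Ultrapower.diag U (a i)) ∘ t) c : Fin (n + 1) → Ultrapower U M)) :
    ∃ c, ¬θ.Realize Empty.elim (Fin.snoc (a ∘ t) c : Fin (n + 1) → M) := by
  by_contra! hcon
  obtain ⟨c, hc⟩ := h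
  obtain ⟨c, rfl⟩ := Ultrapower.exists_rep c
  refine hc ?_
  have e : (Fin.snoc ((fun i => Ultrapower.diag U (a i)) ∘ t) (Ultrapower.mk U c) :
      Fin (n + 1) → Ultrapower U M) =
      fun i => Ultrapower.mk U ((Fin.snoc (fun j _ => a (t j)) c : Fin (n + 1) → M → M) i) := by
    funext i
    refine Fin.lastCases ?_ (fun i => ?_) i
    · simp
    · simp [Ultrapower.diag]
  have e' : (Empty.elim : Empty → Ultrapower U M) = fun i => Ultrapower.mk U (i.elim) :=
    funext fun i => i.elim
  rw [e, e']
  refine (Ultraproduct.boundedFormula_realize_cast θ _ _).2 (Filter.Eventually.of_forall fun s => ?_)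
  have := hcon (c s)
  convert this using 1
  funext i
  refine Fin.lastCases ?_ (fun i => ?_) i
  · simp
  · simp

theorem snoc_comp_eq_elim {n : ℕ} (a : ι → M) (c : M) (t : Fin n → ι) :
    (Fin.snoc (a ∘ t) c : Fin (n + 1) → M) = Sum.elim a (fun _ : Unit => c) ∘
      (Fin.snoc (Sum.inl ∘ t) (Sum.inr ()) : Fin (n + 1) → ι ⊕ Unit) := by
  funext i
  refine Fin.lastCases ?_ (fun i => ?_) i
  · simp
  · simp

variable [(langH L).Structure M] [(langH L).Structure N]

theorem IsInvariant.exists_of_extend [Nonempty M] [Nonempty N] [Finite ι]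
    [IsPredExpansion L D] [IsPredExpansion L E] {n : ℕ}
    {θ : (langH L).BoundedFormula Empty (n + 1)} (hθ : IsInvariant.{u, v, w} θ)
    (hM : IsHStructure L D) (hN : IsHStructure L E) (h : GoodPair L D E a b) (t : Fin n → ι) {d : N}
    (hd : ¬θ.Realize Empty.elim (Fin.snoc (b ∘ t) d : Fin (n + 1) → N))
    (hdE : d ∈ acl L (range b) ∨ d ∈ E ∨ d ∉ acl L (range b ∪ E)) :
    ∃ c, ¬θ.Realize Empty.elim (Fin.snoc (a ∘ t) c : Fin (n + 1) → M) := by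
  obtain ⟨U, hU⟩ := h.exists_extend hM hN d hdE
  refine exists_not_realize_of_ultrapower (U := U) ⟨Ultrapower.mk U id, fun hc => hd ?_⟩
  rw [snoc_comp_eq_elim] at hc ⊢
  exact hθ (ι ⊕ Unit) (Ultrapower U M) N (Ultrapower.pred U D) E _ _ _
    (Ultrapower.isHStructure hM) hN hU hc

/-- The elements of `F` are adjoined first, after which `d` is algebraic over the tuple. Each
adjunction replaces `M` by an ultrapower, which is why `M` and the tuples are quantified inside the
induction. -/
theorem IsInvariant.exists_of_mem_acl [Nonempty N] [IsPredExpansion L E] {n : ℕ}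
    {θ : (langH L).BoundedFormula Empty (n + 1)} (hθ : IsInvariant.{u, v, w} θ)
    (hN : IsHStructure L E) {d : N} {F : Set N} (hF : F.Finite) (hFE : F ⊆ E) :
    ∀ (ι : Type) [Finite ι] (M : Type w) [L.Structure M] [(langH L).Structure M] [Nonempty M]
      (D : Set M) [IsPredExpansion L D] (a : ι → M) (b : ι → N) (t : Fin n → ι),
      IsHStructure L D → GoodPair L D E a b → d ∈ acl L (range b ∪ F) →
      ¬θ.Realize Empty.elim (Fin.snoc (b ∘ t) d : Fin (n + 1) → N) →
      ∃ c, ¬θ.Realize Empty.elim (Fin.snoc (a ∘ t) c : Fin (n + 1) → M) := by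
  induction F, hF using Set.Finite.induction_on with
  | empty =>
    intro ι _ M _ _ _ D _ a b t hM h hd hθd
    rw [union_empty] at hd
    exact hθ.exists_of_extend hM hN h t hθd (Or.inl hd)
  | @insert e F _ _ ih =>
    intro ι _ M _ _ _ D _ a b t hM h hd hθd
    obtain ⟨U, hU⟩ := h.exists_extend hM hN e (Or.inr (Or.inl (hFE (mem_insert _ _))))
    refine exists_not_realize_of_ultrapower (U := U) ?_
    exact ih ((subset_insert _ _).trans hFE) (ι ⊕ Unit) (Ultrapower U M) (Ultrapower.pred U D) _ _
      (Sum.inl ∘ t) (Ultrapower.isHStructure hM) hU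
      (by rwa [range_elim_const, insert_union, ← union_insert]) hθd

theorem isInvariant {n : ℕ} (θ : (langH L).BoundedFormula Empty n) : IsInvariant.{u, v, w} θ := by
  induction θ with
  | falsum => exact fun _ _ _ _ _ _ _ _ _ _ _ _ _ _ _ _ _ _ _ _ h => h
  | equal τ₁ τ₂ => exact isInvariant_equal τ₁ τ₂
  | rel R τ => exact isInvariant_rel R τ
  | imp φ ψ ihφ ihψ =>
    intro ι _ M N _ _ _ _ _ _ D E _ _ a b t hM hN h hab hb
    exact ihψ ι M N D E a b t hM hN h (hab (ihφ ι N M E D b a t hN hM h.symm hb))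
  | all θ ih =>
    intro ι _ M N _ _ _ _ _ _ D E _ _ a b t hM hN h hall
    by_contra hcon
    simp only [BoundedFormula.Realize, not_forall] at hcon hall
    obtain ⟨d, hd⟩ := hcon
    obtain ⟨c, hc⟩ : ∃ c, ¬θ.Realize Empty.elim (Fin.snoc (a ∘ t) c : Fin _ → M) := by
      -- An element algebraic over `b` and `E` may destroy independence over the tuple if added
      -- alone; the finitely many elements of `E` it depends on must come along.
      by_cases hdacl : d ∈ acl L (range b ∪ E)
      · obtain ⟨F, hF, hFfin, hdF⟩ := exists_finite_of_mem_acl hdacl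
        refine ih.exists_of_mem_acl hN (hFfin.inter_of_left E) inter_subset_right ι M D a b t hM h
          (acl_mono ?_ hdF) hd
        intro x hx
        exact (hF hx).imp_right fun hxE => ⟨hx, hxE⟩
      · exact ih.exists_of_extend hM hN h t hd (Or.inr (Or.inr hdacl))
    exact hc (hall c)

theorem IsHStructure.elementarilyEquivalent [Nonempty M] [Nonempty N]
    [IsPredExpansion L D] [IsPredExpansion L E] (hM : IsHStructure L D) (hN : IsHStructure L E)
    (hMN : L.ElementarilyEquivalent M N) : (langH L).ElementarilyEquivalent M N := by
  have key : GoodPair L D E (Empty.elim : Empty → M) (Empty.elim : Empty → N) := by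
    refine ⟨by rw [range_eq_empty]; exact hM.indep, by rw [range_eq_empty]; exact hN.indep,
      fun i => i.elim, fun φ => ?_⟩
    have := elementarilyEquivalent_iff.1 hMN φ
    rw [Sentence.Realize, Sentence.Realize] at this
    convert this
  rw [elementarilyEquivalent_iff]
  intro φ
  have h1 := isInvariant φ Empty M N D E _ _ Fin.elim0 hM hN key
  have h2 := isInvariant φ Empty N M E D _ _ Fin.elim0 hN hM key.symm
  rw [Sentence.Realize, Sentence.Realize, Formula.Realize, Formula.Realize]
  constructor
  · intro h
    convert h1 (by convert h using 1) using 1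
  · intro h
    convert h2 (by convert h using 1) using 1

end Equivalence

/-! ### Maximal independent sets and automorphisms -/

section Independent

variable {L : FirstOrder.Language.{u, v}} {M : Type w} [L.Structure M] {D : Set M}

theorem IndepOver.insert {c : M} (h : IndepOver L D ∅) (hD : IsDense L D) (hc : c ∉ acl L D) :
    IndepOver L (insert c D) ∅ := by
  have hc' := h.insert_of_notMem_acl hD (by rwa [empty_union])
  rintro x (rfl | hx) -
  · rw [empty_union, insert_sdiff_of_mem _ (mem_singleton x)]
    exact fun h => hc (acl_mono sdiff_subset h)
  · have hxc : x ≠ c := by rintro rfl; exact hc (subset_acl _ hx)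
    refine fun h => hc' x hx (by simpa using hxc) (acl_mono ?_ h)
    rw [empty_union]
    rintro y ⟨rfl | hy, hyx⟩
    · exact Or.inl (mem_insert _ _)
    · exact Or.inr ⟨hy, hyx⟩

theorem IndepOver.image (σ : M ≃[L] M) (h : IndepOver L D ∅) : IndepOver L (σ '' D) ∅ := by
  rintro _ ⟨x, hx, rfl⟩ - ⟨ι, _, a, ψ, ha, hfin, hxψ⟩
  have key : ∀ y, y ∈ solutions ψ (σ.symm ∘ a) ↔ σ y ∈ solutions ψ a := by
    intro y
    rw [mem_solutions, mem_solutions, ← StrongHomClass.realize_formula σ]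
    have : σ ∘ Sum.elim (σ.symm ∘ a) (fun _ => y) = Sum.elim a fun _ : Unit => σ y := by
      funext i
      rcases i with i | i
      · exact σ.apply_symm_apply (a i)
      · rfl
    rw [this]
  refine h x hx (notMem_empty _) ⟨ι, inferInstance, σ.symm ∘ a, ψ, fun i => ?_, ?_, (key x).2 hxψ⟩
  · obtain ⟨⟨y, hy, hya⟩, hne⟩ := (ha i).resolve_left (notMem_empty _)
    refine Or.inr ⟨?_, fun e => hne ?_⟩
    · rw [Function.comp_apply, ← hya, σ.symm_apply_apply]
      exact hy
    · rw [mem_singleton_iff] at e ⊢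
      rw [← e, Function.comp_apply, σ.apply_symm_apply]
  · exact (hfin.preimage σ.injective.injOn).subset fun y hy => (key y).1 hy

/-- Zorn's lemma applies because dependence has finite character. -/
theorem IndepOver.exists_maximal (h : IndepOver L D ∅) :
    ∃ D', D ⊆ D' ∧ Maximal (fun E : Set M => IndepOver L E ∅) D' := by
  refine zorn_subset_nonempty {E : Set M | IndepOver L E ∅} ?_ D h
  intro c hc hchain hne
  refine ⟨⋃₀ c, ?_, fun s hs => subset_sUnion_of_mem hs⟩
  intro x hx _ hxacl
  obtain ⟨F, hF, hFfin, hxF⟩ := exists_finite_of_mem_acl hxacl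
  rw [empty_union] at hF
  obtain ⟨E, hE, hsub⟩ := hchain.directedOn.exists_mem_subset_of_finite_of_subset_sUnion hne
    (hFfin.insert x) (insert_subset hx (hF.trans sdiff_subset))
  refine hc hE x (hsub (mem_insert _ _)) (notMem_empty _) (acl_mono ?_ hxF)
  exact fun y hy => Or.inr ⟨hsub (mem_insert_of_mem _ hy), (hF hy).2⟩

/-- An independent set over which some element is not algebraic is not conjugate to a maximal
independent set. -/
theorem image_ne_of_maximal {D' : Set M} {c : M} (h : IndepOver L D ∅) (hD : IsDense L D)
    (hc : c ∉ acl L D) (hD' : Maximal (fun E : Set M => IndepOver L E ∅) D') (σ : M ≃[L] M) :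
    σ '' D ≠ D' := by
  rintro rfl
  have := (h.insert hD hc).image σ
  rw [image_insert_eq] at this
  obtain ⟨x, hx, hxc⟩ := hD'.le_of_ge this (subset_insert _ _) (mem_insert _ _)
  rw [σ.injective hxc] at hx
  exact hc (subset_acl _ hx)

variable [(langH L).Structure M] [IsPredExpansion L D] {κ : Cardinal.{w}}

/-- The formulas true off some small set are finitely satisfiable, by extension and closure of small
sets under unions. A realization lies outside every small set cut out by one `ψ` and `k`, and these
sets cover `acl L D`. -/
theorem IsHStructure.exists_notMem_acl [Infinite M] (hD : IsHStructure L D) (hκ : ℵ₀ ≤ κ)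
    (hM : IsSaturated (langH L) M κ) : ∃ c, c ∉ acl L D := by
  have htop : solutions (⊤ : L.Formula (Empty ⊕ Unit)) (Empty.elim : Empty → M) = Set.univ := by
    ext; simp [mem_solutions]
  have hinf : (solutions (⊤ : L.Formula (Empty ⊕ Unit)) (Empty.elim : Empty → M)).Infinite := by
    rw [htop]; exact infinite_univ
  have hne : D.Nonempty := by
    obtain ⟨x, hx, -⟩ := hD.dense Empty ⊤ _ hinf
    exact ⟨x, hx⟩
  obtain ⟨c, hc⟩ := hM.exists_realize hκ (Empty.elim : Empty → M)
    {χ | ∃ X, IsSmallOver L D (Empty.elim : Empty → M) X ∧ ∀ x ∉ X, x ∈ solutions χ Empty.elim} (by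
      intro q hq hqfin
      obtain ⟨X, ⟨β, _, k, ψ, h1, h2⟩, hX⟩ : ∃ X, IsSmallOver L D (Empty.elim : Empty → M) X ∧
          ∀ x ∉ X, ∀ χ ∈ q, x ∈ solutions χ Empty.elim := by
        induction q, hqfin using Set.Finite.induction_on with
        | empty => exact ⟨∅, isSmallOver_empty, by simp⟩
        | @insert χ q _ _ ih =>
          obtain ⟨X, hX, hXq⟩ := ih ((subset_insert _ _).trans hq)
          obtain ⟨Y, hY, hYχ⟩ := hq (mem_insert _ _)
          refine ⟨Y ∪ X, hY.union hX hne, fun x hx => ?_⟩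
          rw [mem_union, not_or] at hx
          rintro φ (rfl | hφ)
          exacts [hYχ x hx.1, hXq x hx.2 φ hφ]
      obtain ⟨x, -, hx⟩ := hD.extension Empty β k ⊤ ψ _ h1 hinf
      refine ⟨x, hX x fun hxX => ?_⟩
      obtain ⟨g, hg, hxg⟩ := h2 x hxX
      exact hx g hg hxg)
  refine ⟨c, fun hcacl => ?_⟩
  rw [← empty_union D, ← range_eq_empty (Empty.elim : Empty → M)] at hcacl
  obtain ⟨β, _, g, ψ, hg, hfin, hψ⟩ := mem_acl_range_union hcacl
  obtain ⟨k, hk⟩ := finite_iff_exists_lt.1 hfin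
  let χ : (langH L).Formula (Empty ⊕ Unit) := ∼(Formula.iExs β
    ((Formula.iInf fun i : β => inH (Sum.inr i)) ⊓
      lift (ψ.relabel (Sum.elim (Sum.elim Empty.elim Sum.inr) (Sum.inl ∘ Sum.inr)) ⊓
        ∼((atLeast k ψ).relabel (Sum.elim Empty.elim Sum.inr)))))
  have hχ : ∀ x, x ∈ solutions χ Empty.elim ↔ ¬∃ h : β → M, (∀ i, h i ∈ D) ∧
      x ∈ solutions ψ (Sum.elim Empty.elim h) ∧
        (solutions ψ (Sum.elim Empty.elim h)).encard < k := by
    intro x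
    rw [mem_solutions]
    simp only [χ, Formula.realize_not, Formula.realize_iExs, Formula.realize_inf,
      Formula.realize_iInf, realize_inH D, realize_lift D, Formula.realize_relabel, Sum.elim_inr]
    refine not_congr (exists_congr fun h => and_congr Iff.rfl ?_)
    rw [mem_solutions, ← not_le, ← realize_atLeast]
    have e1 : (Sum.elim (Sum.elim (Empty.elim : Empty → M) fun _ : Unit => x) h) ∘
        (Sum.elim (Sum.elim Empty.elim Sum.inr) (Sum.inl ∘ Sum.inr)) =
        Sum.elim (Sum.elim Empty.elim h) fun _ => x := by
      funext i
      rcases i with (i | i) | i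
      exacts [i.elim, rfl, rfl]
    have e2 : (Sum.elim (Sum.elim (Empty.elim : Empty → M) fun _ : Unit => x) h) ∘
        (Sum.elim Empty.elim Sum.inr) = Sum.elim Empty.elim h := by
      funext i
      rcases i with i | i
      exacts [i.elim, rfl]
    rw [e1, e2]
  refine (hχ c).1 (hc χ ⟨_, isSmallOver_of_formula k ψ, fun x hx => (hχ x).2 hx⟩) ⟨g, hg, hψ, hk⟩

end Independent

/-! ### Isomorphisms of expansions -/

section Reduct

variable {L : FirstOrder.Language.{u, v}} {M : Type w} [L.Structure M] {D : Set M}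

/-- An isomorphism of expansions by unary predicates induces an automorphism of the reduct. -/
theorem exists_equiv_of_expansion_equiv {D' : Set M}
    (τ : Expansion D ≃[langH L] Expansion D') : ∃ σ : M ≃[L] M, σ '' D = D' := by
  let σ : M ≃[L] M :=
    { toEquiv := τ.toEquiv
      map_fun' := fun {n} f x => τ.map_fun' (Sum.inl f : (langH L).Functions n) x
      map_rel' := fun {n} r x => τ.map_rel' (Sum.inl r : (langH L).Relations n) x }
  refine ⟨σ, ?_⟩
  have hσ : ∀ x, σ x ∈ D' ↔ x ∈ D := fun x =>
    τ.map_rel' (symH : (langH L).Relations 1) fun _ => x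
  ext y
  constructor
  · rintro ⟨x, hx, rfl⟩
    exact (hσ x).2 hx
  · intro hy
    exact ⟨σ.symm y, (hσ _).1 (by rwa [σ.apply_symm_apply]), σ.apply_symm_apply y⟩

end Reduct

/-! ### Bases are maximal independent sets -/

section Basis

variable {L : FirstOrder.Language.{u, v}} [L.IsOrdered] {M : Type w} [L.Structure M]
  [LinearOrder M] [L.OrderedStructure M] {D : Set M}

theorem IsDclBasis.maximal (h : IsDclBasis L D) :
    Maximal (fun E : Set M => IndepOver L E ∅) D := by
  refine ⟨fun x hx _ => ?_, fun E hE hDE x hx => ?_⟩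
  · rw [empty_union, acl_eq_dcl]
    exact h.1 x hx
  · by_contra hxD
    refine hE x hx (notMem_empty _) (acl_mono ?_ (?_ : x ∈ acl L D))
    · exact fun y hy => Or.inr ⟨hDE hy, by rintro rfl; exact hxD hy⟩
    · rw [acl_eq_dcl, h.2]
      exact mem_univ x

end Basis

end HStruct

/-! ### The main theorem -/

theorem proposition4p1 {L : FirstOrder.Language.{u, v}} [L.IsOrdered] (T : L.Theory)
    (hT : HStruct.IsOMinimalTheory.{u, v, w'} T)
    {C : Type w} [L.Structure C] [LinearOrder C] [L.OrderedStructure C]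
    (H : Set C) (κ : Cardinal.{w})
    (hmodel : HStruct.ModelsIndep T H)
    (hmonster : HStruct.IsMonster (HStruct.langH L) (HStruct.Expansion H) κ)
    (f : C → C → C) (hf : HStruct.ZeroDefinable₂ L f)
    (hinter : ∀ x y : C, HStruct.Interdefinable L {x} (f x y) y ∧
      HStruct.Interdefinable L {y} (f x y) x)
    (hinterval : ∀ a b : C, a < b → ∃ a' b' : C, a' < b' ∧
      ∀ x ∈ Set.Ioo a' b', ∀ y ∈ Set.Ioo a' b', f x y ∈ Set.Ioo a b) :
    (∀ H' : Set C, H ⊆ H' → HStruct.IsDclBasis L H' →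
      (HStruct.langH L).ElementarilyEquivalent (HStruct.Expansion H) (HStruct.Expansion H') ∧
      IsEmpty (HStruct.Expansion H ≃[HStruct.langH L] HStruct.Expansion H')) ∧
    HStruct.orbit L H ≠ HStruct.elemClass L H := by
  open HStruct in
  have hκ : ℵ₀ ≤ κ := hmonster.inaccessible.aleph0_lt.le
  have hCκ : #C = κ := hmonster.card_eq
  have : Infinite C := Cardinal.infinite_iff.2 (hκ.trans hCκ.ge)
  have hdense : IsDense L H := hmodel.isDense
  have hind : IndepOver L H ∅ := hmodel.indepOver
  let _ : LinearOrder (Expansion H) := inferInstanceAs (LinearOrder C)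
  have : L.OrderedStructure (Expansion H) := inferInstanceAs (L.OrderedStructure C)
  have hfin : UniformFinite L C :=
    IsDense.uniformFinite (L := L) (M := Expansion H) (D := H) hdense hind hκ hmonster.saturated
  have : DenselyOrdered C := hT.denselyOrdered hmodel.models
  have hH : ∀ D : Set C, H ⊆ D → IndepOver L D ∅ → IsHStructure L D := fun D hD hDind =>
    isHStructure_of_indepOver hfin
      (fun ι _ φ a h => hT.exists_Ioo_subset hmodel.models hfin h) (hdense.mono hD) hDind
      (fun x y => by
        rw [Set.pair_comm]
        exact dcl_subset_acl _ (hinter x y).1.1)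
      (fun x y => dcl_subset_acl _ (hinter x y).2.2)
      (fun x y => dcl_subset_acl _ (hinter x y).1.2) hinterval
  have hequiv : ∀ D : Set C, H ⊆ D → IndepOver L D ∅ →
      (langH L).ElementarilyEquivalent (Expansion H) (Expansion D) := fun D hD hDind =>
    have : Nonempty (Expansion H) := inferInstanceAs (Nonempty C)
    have : Nonempty (Expansion D) := inferInstanceAs (Nonempty C)
    IsHStructure.elementarilyEquivalent (L := L) (M := Expansion H) (N := Expansion D)
      (D := H) (E := D) (hH H subset_rfl hind) (hH D hD hDind) rfl
  obtain ⟨c, hc⟩ : ∃ c, c ∉ acl L H :=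
    have : Infinite (Expansion H) := inferInstanceAs (Infinite C)
    IsHStructure.exists_notMem_acl (L := L) (M := Expansion H) (D := H) (hH H subset_rfl hind) hκ
      hmonster.saturated
  refine ⟨fun H' hHH' hbasis => ⟨hequiv H' hHH' hbasis.maximal.prop, ⟨fun τ => ?_⟩⟩, fun heq => ?_⟩
  · obtain ⟨σ, hσ⟩ := exists_equiv_of_expansion_equiv τ
    exact image_ne_of_maximal hind hdense hc hbasis.maximal σ hσ
  -- Maximality is all that is needed here, so no basis extending `H` has to be produced.
  · obtain ⟨H', hHH', hmax⟩ := hind.exists_maximal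
    have : H' ∈ orbit L H := heq ▸ hequiv H' hHH' hmax.prop
    obtain ⟨σ, hσ⟩ := this
    exact image_ne_of_maximal hind hdense hc hmax σ hσ
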